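/- Let $d\ge 1$ and $B(x,r)=\{z\in\mathbb R^d:|x-z|<r\}$, $B_r=B(0,r)$. For $\alpha\in(0,2)$ consider measurable kernels $k:\mathbb R^d\times\mathbb R^d\to[0,\infty)$ with $k(x,y)=k(y,x)$ for which there are measurable functions $L,U:\mathbb R^d\to[0,\infty)$ such that $L(x-y)\le k(x,y)\le U(x-y)$ for almost every $x,y$; $L(x)=L(-x)$ and $U(x)=U(-x)$ for almost every $x$; $L\neq0$ on a set of positive measure; and, for constants $a>1$ and $C_0,C_1,C_2,C_3>0$: (U0) $\displaystyle\int_{\mathbb R^d}(|z|^2\wedge1)\,U(z)\,dz\le C_0$; (U1) $\displaystyle\int_{B_r}|z|^2U(z)\,dz\le C_1r^{2-\alpha}$ for every $r\in(0,1)$; (L1) for every $n=0,1,2,\dots$ the annulus $B_{a^{-n+1}}\setminus B_{a^{-n}}$ contains a ball $B^{(n)}$ of radius $C_2a^{-n}$ such that $L(z)\ge C_3(2-\alpha)|z|^{-d-\alpha}$ for all $z\in B^{(n)}$. Denote by $\mathcal K_\alpha=\mathcal K_\alpha(d,a,C_0,C_1,C_2,C_3)$ the set of all these kernels. **Theorem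 1.1.** Let $\alpha_0\in(0,2)$, $a>1$ and $C_0,C_1,C_2,C_3>0$. Then the following two conditions hold. (A) There are constants $c_1,c_2>0$, depending only on $d,\alpha_0,a,C_0,C_1,C_2,C_3$, such that for every $\alpha\in(\alpha_0,2)$, every $k\in\mathcal K_\alpha$, every ball $B=B(x_0,r)$ with $x_0\in\mathbb R^d$, $0<r<1$, and every $u\in C_c^\infty(B)$, $$c_1(2-\alpha)\iint_{B\times B}\frac{(u(y)-u(x))^2}{|x-y|^{d+\alpha}}\,dy\,dx\le\iint_{B\times B}(u(y)-u(x))^2k(x,y)\,dy\,dx\le c_2(2-\alpha)\iint_{B\times B}\frac{(u(y)-u(x))^2}{|x-y|^{d+\alpha}}\,dy\,dx .$$ (B) There is a constant $c>0$, depending only on $d,\alpha_0,a,C_0,C_1,C_2,C_3$, such that for all $R,\rho\in(0,1)$ there is a nonnegative $\tau\in C^\infty(\mathbb R^d)$ with $\operatorname{supp}\tau=\overline{B_{R+\rho}}$ and $\tau\equiv1$ on $B_R$ such that for every $\alpha\in(\alpha_0,2)$ and every $k\in\mathcal K_\alpha$ $$\operatorname*{ess\,sup}_{x\in\mathbb R^d}\int_{\mathbb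 R^d}(\tau(y)-\tau(x))^2\,k(x,y)\,dy\le c\,\rho^{-\alpha}.$$ -/

import Mathlib

open MeasureTheory Set Metric
open scoped NNReal ENNReal ContDiff

noncomputable section

/-- The quadratic form `∬_{D×D} (u(y) - u(x))² k(x,y) dy dx`, with value in `[0,∞]`. -/
def kernelEnergy {d : ℕ} (k : EuclideanSpace ℝ (Fin d) → EuclideanSpace ℝ (Fin d) → ℝ≥0)
    (D : Set (EuclideanSpace ℝ (Fin d))) (u : EuclideanSpace ℝ (Fin d) → ℝ) : ℝ≥0∞ :=
  ∫⁻ x in D, ∫⁻ y in D, ENNReal.ofReal ((u y - u x) ^ 2) * (k x y : ℝ≥0∞)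

/-- The Gagliardo form `∬_{D×D} (u(y) - u(x))² / |x - y|^(d+α) dy dx`, with value in `[0,∞]`
(the integrand is `0` on the diagonal). -/
def gagliardoEnergy {d : ℕ} (α : ℝ)
    (D : Set (EuclideanSpace ℝ (Fin d))) (u : EuclideanSpace ℝ (Fin d) → ℝ) : ℝ≥0∞ :=
  ∫⁻ x in D, ∫⁻ y in D, ENNReal.ofReal ((u y - u x) ^ 2 / ‖x - y‖ ^ ((d : ℝ) + α))

/-- Standing assumption on the kernel: `k` is (Lebesgue) measurable and symmetric, and it lies
almost everywhere between `L (x - y)` and `U (x - y)` for measurable functions `L`, `U` that are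
even almost everywhere, where `L` does not vanish almost everywhere. -/
structure KernelBounds {d : ℕ}
    (k : EuclideanSpace ℝ (Fin d) → EuclideanSpace ℝ (Fin d) → ℝ≥0)
    (L U : EuclideanSpace ℝ (Fin d) → ℝ≥0) : Prop where
  aemeasurable_k : AEMeasurable (Function.uncurry k) volume
  aemeasurable_L : AEMeasurable L volume
  aemeasurable_U : AEMeasurable U volume
  symm : ∀ x y, k x y = k y x
  L_even : ∀ᵐ x, L x = L (-x)
  U_even : ∀ᵐ x, U x = U (-x)
  L_ne_zero : 0 < volume {x | L x ≠ 0}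
  bounds : ∀ᵐ p : EuclideanSpace ℝ (Fin d) × EuclideanSpace ℝ (Fin d),
    L (p.1 - p.2) ≤ k p.1 p.2 ∧ k p.1 p.2 ≤ U (p.1 - p.2)

/-- `∫ (|z|² ∧ 1) U(z) dz ≤ C₀`. -/
def ConditionU0 {d : ℕ} (C₀ : ℝ) (U : EuclideanSpace ℝ (Fin d) → ℝ≥0) : Prop :=
  ∫⁻ z, ENNReal.ofReal (min (‖z‖ ^ 2) 1) * (U z : ℝ≥0∞) ≤ ENNReal.ofReal C₀

/-- `∫_{B(0,r)} |z|² U(z) dz ≤ C₁ r^(2-α)` for every `r ∈ (0,1)`. -/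
def ConditionU1 {d : ℕ} (α C₁ : ℝ) (U : EuclideanSpace ℝ (Fin d) → ℝ≥0) : Prop :=
  ∀ r ∈ Ioo (0 : ℝ) 1,
    ∫⁻ z in ball 0 r, ENNReal.ofReal (‖z‖ ^ 2) * (U z : ℝ≥0∞) ≤ ENNReal.ofReal (C₁ * r ^ (2 - α))

/-- For every `n = 0, 1, …` the annulus `B_{a^{-n+1}} \ B_{a^{-n}}` contains a ball of radius
`C₂ a^{-n}` on which `L(z) ≥ C₃ (2-α) |z|^(-d-α)`. -/
def ConditionL1 {d : ℕ} (α a C₂ C₃ : ℝ) (L : EuclideanSpace ℝ (Fin d) → ℝ≥0) : Prop :=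
  ∀ n : ℕ, ∃ z₀ : EuclideanSpace ℝ (Fin d),
    ball z₀ (C₂ * a ^ (-(n : ℤ))) ⊆ ball 0 (a ^ (-(n : ℤ) + 1)) \ ball 0 (a ^ (-(n : ℤ))) ∧
    ∀ z ∈ ball z₀ (C₂ * a ^ (-(n : ℤ))), C₃ * (2 - α) * ‖z‖ ^ (-(d : ℝ) - α) ≤ (L z : ℝ)

/-- The kernels of order `α` that satisfy the standing assumption together with (U0), (U1), (L1)
with the given constants. -/
def admissibleKernels (d : ℕ) (a C₀ C₁ C₂ C₃ α : ℝ) :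
    Set (EuclideanSpace ℝ (Fin d) → EuclideanSpace ℝ (Fin d) → ℝ≥0) :=
  {k | ∃ L U : EuclideanSpace ℝ (Fin d) → ℝ≥0, KernelBounds k L U ∧
    ConditionU0 C₀ U ∧ ConditionU1 α C₁ U ∧ ConditionL1 α a C₂ C₃ L}

/-- Condition (A) for a family of sets of kernels indexed by `α ∈ (α₀,2)`: on every ball `B` of
radius `r < 1` and for every `u ∈ C_c^∞(B)` the form of `k` is comparable to `(2-α)` times the
Gagliardo form, with constants uniform over the whole family. -/
def ConditionA {d : ℕ} (α₀ : ℝ)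
    (𝒦 : ℝ → Set (EuclideanSpace ℝ (Fin d) → EuclideanSpace ℝ (Fin d) → ℝ≥0)) : Prop :=
  ∃ c₁ c₂ : ℝ, 0 < c₁ ∧ 0 < c₂ ∧
    ∀ α ∈ Ioo α₀ 2, ∀ k ∈ 𝒦 α,
    ∀ (x₀ : EuclideanSpace ℝ (Fin d)), ∀ r ∈ Ioo (0 : ℝ) 1,
    ∀ u : EuclideanSpace ℝ (Fin d) → ℝ,
      ContDiff ℝ ∞ u → HasCompactSupport u → tsupport u ⊆ ball x₀ r →
      ENNReal.ofReal c₁ * (ENNReal.ofReal (2 - α) * gagliardoEnergy α (ball x₀ r) u)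
          ≤ kernelEnergy k (ball x₀ r) u ∧
      kernelEnergy k (ball x₀ r) u
          ≤ ENNReal.ofReal c₂ * (ENNReal.ofReal (2 - α) * gagliardoEnergy α (ball x₀ r) u)

/-- Condition (B) for a family of sets of kernels indexed by `α ∈ (α₀,2)`: for all
`R, ρ ∈ (0,1)` there is one smooth cutoff function `τ` that works for every kernel of the family.
The supremum over `x` is an essential supremum. -/
def ConditionB {d : ℕ} (α₀ : ℝ)
    (𝒦 : ℝ → Set (EuclideanSpace ℝ (Fin d) → EuclideanSpace ℝ (Fin d) → ℝ≥0)) : Prop :=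
  ∃ c : ℝ, 0 < c ∧ ∀ R ∈ Ioo (0 : ℝ) 1, ∀ ρ ∈ Ioo (0 : ℝ) 1,
    ∃ τ : EuclideanSpace ℝ (Fin d) → ℝ,
      ContDiff ℝ ∞ τ ∧ (∀ x, 0 ≤ τ x) ∧
      tsupport τ = closure (ball 0 (R + ρ)) ∧ (∀ x ∈ ball 0 R, τ x = 1) ∧
      ∀ α ∈ Ioo α₀ 2, ∀ k ∈ 𝒦 α,
        essSup (fun x => ∫⁻ y, ENNReal.ofReal ((τ y - τ x) ^ 2) * (k x y : ℝ≥0∞)) volume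
          ≤ ENNReal.ofReal (c * ρ ^ (-α))

end

/-! For a ball D put Φ(h) = ∫ (u(x - h) - u(x))² dx over x with x, x - h ∈ D (`shiftEnergy`). By
Tonelli the Gagliardo form is ∫ Φ(h) |h|^(-d-α) dh, and the form of k lies between ∫ Φ L and ∫ Φ U.
So (A) compares weighted integrals of the single function Φ. Convexity of D gives Φ(nh) ≤ n² Φ(h)
(`shiftEnergy_natCast_smul_le`), and averaging the triangle inequality over intermediate points
bounds Φ(h) by the mean of Φ over a set of other shifts (`mul_shiftEnergy_le`).

Upper bound. U is controlled only through integrals, so Φ has to be bounded pointwise on each dyadic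
shell; `exists_shiftEnergy_le_shell` does this by an integral over a smaller shell. After
normalisation these bounds increase as the shells shrink. Bounding the U-mass of each shell
separately would lose a factor 1/(2-α). Instead (U1) bounds the tail sums of these masses by a
geometric sequence of ratio q = 2^(α-2), and Abel summation (`ENNReal.tsum_mul_le_of_monotone`)
yields the factor 1 - q ≤ 2 - α.

Lower bound. L is large only on the balls of (L1), centred at z, say. A small shift h is split as a
step close to ±z followed by a step close to ∓z. For every point of D one of the two signs stays
inside D (`exists_ball_shift`). Thus each ball controls a full shell of smaller shifts, and Φ(Nh) ≤
N² Φ(h) reduces all shifts to such small ones.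

For (B), a cutoff with slope of order 1/ρ is combined with (U1) for |x - y| < ρ and with the bound
of order ρ^(-α) for the mass of U outside the ball of radius ρ (`setLIntegral_tail_le`). -/

set_option linter.unusedSectionVars false

/-! ### Energy of a single shift: convexity, averaging, reduction of double integrals. -/

section ShiftEnergy

variable {E : Type*} [NormedAddCommGroup E] [InnerProductSpace ℝ E]

/-- The squared increment of `u` between two points of `D`, extended by `0`. -/
noncomputable def pairDiff (D : Set E) (u : E → ℝ) (x y : E) : ℝ≥0∞ :=
  (D ×ˢ D).indicator (fun p => ENNReal.ofReal ((u p.2 - u p.1) ^ 2)) (x, y)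

lemma pairDiff_of_mem {D : Set E} {u : E → ℝ} {x y : E} (hx : x ∈ D) (hy : y ∈ D) :
    pairDiff D u x y = ENNReal.ofReal ((u y - u x) ^ 2) :=
  indicator_of_mem (mk_mem_prod hx hy) _

lemma pairDiff_of_notMem {D : Set E} {u : E → ℝ} {x y : E} (h : ¬ (x ∈ D ∧ y ∈ D)) :
    pairDiff D u x y = 0 :=
  indicator_of_notMem (by simpa using h) _

lemma pairDiff_comm (D : Set E) (u : E → ℝ) (x y : E) : pairDiff D u x y = pairDiff D u y x := by
  by_cases h : x ∈ D ∧ y ∈ D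
  · rw [pairDiff_of_mem h.1 h.2, pairDiff_of_mem h.2 h.1]
    congr 1
    ring
  · rw [pairDiff_of_notMem h, pairDiff_of_notMem (fun h' => h h'.symm)]

lemma pairDiff_triangle {D : Set E} (u : E → ℝ) (x y : E) {w : E} (hw : w ∈ D) :
    pairDiff D u x y ≤ 2 * (pairDiff D u x w + pairDiff D u w y) := by
  by_cases h : x ∈ D ∧ y ∈ D
  · rw [pairDiff_of_mem h.1 h.2, pairDiff_of_mem h.1 hw, pairDiff_of_mem hw h.2,
      ← ENNReal.ofReal_add (sq_nonneg _) (sq_nonneg _), ← ENNReal.ofReal_ofNat 2,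
      ← ENNReal.ofReal_mul (by norm_num)]
    refine ENNReal.ofReal_le_ofReal ?_
    nlinarith [sq_nonneg (u y - u w - (u w - u x))]
  · rw [pairDiff_of_notMem h]
    exact zero_le

/-- Cauchy–Schwarz for the telescoping sum over n equal steps; convexity keeps all intermediate
points in D. -/
lemma pairDiff_nsmul_le {D : Set E} (hD : Convex ℝ D) (u : E → ℝ) (x h : E) (n : ℕ) :
    pairDiff D u x (x - (n : ℝ) • h) ≤
      n * ∑ i ∈ Finset.range n, pairDiff D u (x - (i : ℝ) • h) (x - (i : ℝ) • h - h) := by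
  by_cases hm : x ∈ D ∧ x - (n : ℝ) • h ∈ D
  · have mem : ∀ i ≤ n, x - (i : ℝ) • h ∈ D := by
      intro i hi
      rcases Nat.eq_zero_or_pos n with rfl | hn
      · obtain rfl : i = 0 := by omega
        simpa using hm.1
      have hn' : (0 : ℝ) < n := by exact_mod_cast hn
      have := hD hm.1 hm.2 (a := 1 - i / n) (b := i / n)
        (sub_nonneg.2 ((div_le_one hn').2 (by exact_mod_cast hi))) (by positivity) (by ring)
      convert this using 1
      rw [smul_sub, smul_smul, div_mul_cancel₀ _ hn'.ne', sub_smul, one_smul]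
      abel
    have step : ∀ i ∈ Finset.range n, pairDiff D u (x - (i : ℝ) • h) (x - (i : ℝ) • h - h) =
        ENNReal.ofReal ((u (x - ((i + 1 : ℕ) : ℝ) • h) - u (x - (i : ℝ) • h)) ^ 2) := by
      intro i hi
      have hi' := Finset.mem_range.1 hi
      have e : x - (i : ℝ) • h - h = x - ((i + 1 : ℕ) : ℝ) • h := by
        push_cast
        rw [add_smul, one_smul]
        abel
      rw [e, pairDiff_of_mem (mem i hi'.le) (mem (i + 1) hi')]
    rw [Finset.sum_congr rfl step, pairDiff_of_mem hm.1 hm.2,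
      ← ENNReal.ofReal_sum_of_nonneg (fun _ _ => sq_nonneg _), ← ENNReal.ofReal_natCast,
      ← ENNReal.ofReal_mul (by positivity)]
    refine ENNReal.ofReal_le_ofReal ?_
    have := sq_sum_le_card_mul_sum_sq (s := Finset.range n)
      (f := fun i => u (x - ((i + 1 : ℕ) : ℝ) • h) - u (x - (i : ℝ) • h))
    rw [Finset.sum_range_sub (fun i : ℕ => u (x - (i : ℝ) • h))] at this
    simpa using this
  · rw [pairDiff_of_notMem hm]
    exact zero_le

variable [FiniteDimensional ℝ E] [MeasurableSpace E] [BorelSpace E]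

lemma measurable_pairDiff {D : Set E} (hD : MeasurableSet D) {u : E → ℝ} (hu : Measurable u) :
    Measurable (fun p : E × E => pairDiff D u p.1 p.2) :=
  Measurable.indicator (by fun_prop) (hD.prod hD)

/-- `∫_{x, x - h ∈ D} (u(x - h) - u(x))² dx`. -/
noncomputable def shiftEnergy (μ : Measure E) (D : Set E) (u : E → ℝ) (h : E) : ℝ≥0∞ :=
  ∫⁻ x, pairDiff D u x (x - h) ∂μ

variable {μ : Measure E} [μ.IsAddHaarMeasure]

lemma measurable_shiftEnergy {D : Set E} (hD : MeasurableSet D) {u : E → ℝ} (hu : Measurable u) :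
    Measurable (shiftEnergy μ D u) := by
  have : Measurable (fun p : E × E => pairDiff D u p.2 (p.2 - p.1)) :=
    (measurable_pairDiff hD hu).comp (measurable_snd.prodMk (measurable_snd.sub measurable_fst))
  exact this.lintegral_prod_right'

lemma shiftEnergy_neg (D : Set E) (u : E → ℝ) (h : E) :
    shiftEnergy μ D u (-h) = shiftEnergy μ D u h := by
  unfold shiftEnergy
  rw [← lintegral_sub_right_eq_self _ h]
  refine lintegral_congr fun x => ?_
  rw [pairDiff_comm, sub_neg_eq_add, sub_add_cancel]

lemma shiftEnergy_zero (D : Set E) (u : E → ℝ) : shiftEnergy μ D u 0 = 0 := by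
  unfold shiftEnergy
  have : ∀ x, pairDiff D u x (x - 0) = 0 := by
    intro x
    by_cases hx : x ∈ D
    · rw [sub_zero, pairDiff_of_mem hx hx]; simp
    · exact pairDiff_of_notMem (fun h => hx h.1)
  simp_rw [this]
  exact lintegral_zero

/-- Substitute h = x - y and apply Tonelli. This turns forms with a translation invariant kernel
into weighted integrals of `shiftEnergy`. -/
lemma lintegral_pairDiff_mul {D : Set E} (hD : MeasurableSet D) {u : E → ℝ} (hu : Measurable u)
    {W : E → ℝ≥0∞} (hW : Measurable W) :
    ∫⁻ x, ∫⁻ y, pairDiff D u x y * W (x - y) ∂μ ∂μ = ∫⁻ h, shiftEnergy μ D u h * W h ∂μ := by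
  have h1 : ∀ x, ∫⁻ y, pairDiff D u x y * W (x - y) ∂μ =
      ∫⁻ h, pairDiff D u x (x - h) * W h ∂μ := by
    intro x
    rw [← lintegral_sub_left_eq_self _ x]
    simp only [sub_sub_cancel]
  simp_rw [h1]
  have hm : Measurable (fun p : E × E => pairDiff D u p.1 (p.1 - p.2)) :=
    (measurable_pairDiff hD hu).comp (measurable_fst.prodMk (measurable_fst.sub measurable_snd))
  rw [lintegral_lintegral_swap]
  · refine lintegral_congr fun h => ?_
    rw [shiftEnergy, lintegral_mul_const]
    exact hm.comp (measurable_id.prodMk measurable_const)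
  · exact (hm.mul (hW.comp measurable_snd)).aemeasurable

lemma setLIntegral_setLIntegral_eq_pairDiff {D : Set E} (hD : MeasurableSet D) (u : E → ℝ)
    (W : E → E → ℝ≥0∞) :
    ∫⁻ x in D, ∫⁻ y in D, ENNReal.ofReal ((u y - u x) ^ 2) * W x y ∂μ ∂μ =
      ∫⁻ x, ∫⁻ y, pairDiff D u x y * W x y ∂μ ∂μ := by
  rw [← lintegral_indicator hD]
  refine lintegral_congr fun x => ?_
  by_cases hx : x ∈ D
  · rw [indicator_of_mem hx, ← lintegral_indicator hD]
    refine lintegral_congr fun y => ?_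
    by_cases hy : y ∈ D
    · rw [indicator_of_mem hy, pairDiff_of_mem hx hy]
    · rw [indicator_of_notMem hy, pairDiff_of_notMem (fun h => hy h.2), zero_mul]
  · rw [indicator_of_notMem hx]
    simp [pairDiff_of_notMem (D := D) (u := u) (x := x) (fun h => hx h.1)]

lemma shiftEnergy_natCast_smul_le {D : Set E} (hD : MeasurableSet D) (hc : Convex ℝ D) {u : E → ℝ}
    (hu : Measurable u) (h : E) (n : ℕ) :
    shiftEnergy μ D u ((n : ℝ) • h) ≤ (n : ℝ≥0∞) ^ 2 * shiftEnergy μ D u h := by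
  have hm : Measurable (fun x => pairDiff D u x (x - h)) :=
    (measurable_pairDiff hD hu).comp (measurable_id.prodMk (measurable_id.sub_const h))
  have hm' : ∀ i : ℕ, Measurable
      (fun x => pairDiff D u (x - (i : ℝ) • h) (x - (i : ℝ) • h - h)) :=
    fun i => hm.comp (measurable_id.sub_const _)
  calc shiftEnergy μ D u ((n : ℝ) • h)
      ≤ ∫⁻ x, n * ∑ i ∈ Finset.range n,
          pairDiff D u (x - (i : ℝ) • h) (x - (i : ℝ) • h - h) ∂μ :=
        lintegral_mono fun x => pairDiff_nsmul_le hc u x h n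
    _ = n * ∑ i ∈ Finset.range n, shiftEnergy μ D u h := by
        rw [lintegral_const_mul _ (Finset.measurable_sum _ fun i _ => hm' i),
          lintegral_finsetSum _ fun i _ => hm' i]
        congr 1
        refine Finset.sum_congr rfl fun i _ => ?_
        exact lintegral_sub_right_eq_self (fun x => pairDiff D u x (x - h)) ((i : ℝ) • h)
    _ = (n : ℝ≥0∞) ^ 2 * shiftEnergy μ D u h := by
        rw [Finset.sum_const, Finset.card_range, nsmul_eq_mul, sq, mul_assoc]

lemma shiftEnergy_eq_zero_of_le_norm {x₀ h : E} {r : ℝ} (u : E → ℝ) (hh : 2 * r ≤ ‖h‖) :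
    shiftEnergy μ (ball x₀ r) u h = 0 := by
  unfold shiftEnergy
  have : ∀ x, pairDiff (ball x₀ r) u x (x - h) = 0 := by
    intro x
    refine pairDiff_of_notMem fun ⟨h1, h2⟩ => ?_
    have h3 : dist x (x - h) < r + r :=
      (dist_triangle_right x (x - h) x₀).trans_lt (add_lt_add h1 h2)
    rw [dist_eq_norm, sub_sub_cancel] at h3
    linarith
  simp [this]

/-- Averaging the triangle inequality over intermediate points. -/
lemma mul_shiftEnergy_le {D : Set E} (hD : MeasurableSet D) {u : E → ℝ} (hu : Measurable u)
    {Z : Set E} (hZ : MeasurableSet Z) {h : E} {v : ℝ≥0∞}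
    (hv : ∀ x ∈ D, x - h ∈ D → ∃ p δ, v ≤ μ (ball p δ) ∧
      ∀ w ∈ ball p δ, w ∈ D ∧ x - w ∈ Z ∧ w - (x - h) ∈ Z) :
    v * shiftEnergy μ D u h ≤ 4 * ∫⁻ z in Z, shiftEnergy μ D u z ∂μ := by
  have hW : Measurable (Z.indicator (1 : E → ℝ≥0∞)) := measurable_one.indicator hZ
  set G : E → E → ℝ≥0∞ := fun x w => pairDiff D u x w * Z.indicator 1 (x - w) with hG
  have hGm : Measurable (fun p : E × E => G p.1 p.2) :=
    (measurable_pairDiff hD hu).mul (hW.comp (measurable_fst.sub measurable_snd))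
  have hGint : ∫⁻ x, ∫⁻ w, G x w ∂μ ∂μ = ∫⁻ z in Z, shiftEnergy μ D u z ∂μ := by
    rw [hG, lintegral_pairDiff_mul hD hu hW, ← lintegral_indicator hZ]
    refine lintegral_congr fun z => ?_
    by_cases hz : z ∈ Z <;> simp [hz]
  have key : ∀ x, v * pairDiff D u x (x - h) ≤
      2 * ((∫⁻ w, G x w ∂μ) + ∫⁻ w, G w (x - h) ∂μ) := by
    intro x
    by_cases hx : x ∈ D ∧ x - h ∈ D
    · obtain ⟨p, δ, hvp, hp⟩ := hv x hx.1 hx.2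
      have m1 : Measurable (fun w => G x w) := hGm.comp (measurable_const.prodMk measurable_id)
      have m2 : Measurable (fun w => G w (x - h)) :=
        hGm.comp (measurable_id.prodMk measurable_const)
      calc v * pairDiff D u x (x - h) ≤ μ (ball p δ) * pairDiff D u x (x - h) := by gcongr
        _ = ∫⁻ w in ball p δ, pairDiff D u x (x - h) ∂μ := by
            rw [setLIntegral_const, mul_comm]
        _ ≤ ∫⁻ w in ball p δ, 2 * (G x w + G w (x - h)) ∂μ := by
            refine setLIntegral_mono' measurableSet_ball fun w hw => ?_
            obtain ⟨h1, h2, h3⟩ := hp w hw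
            simp only [hG, indicator_of_mem h2, indicator_of_mem h3, Pi.one_apply, mul_one]
            exact pairDiff_triangle u _ _ h1
        _ ≤ ∫⁻ w, 2 * (G x w + G w (x - h)) ∂μ := setLIntegral_le_lintegral _ _
        _ = _ := by rw [lintegral_const_mul' _ _ (by simp), lintegral_add_left m1]
    · rw [pairDiff_of_notMem hx, mul_zero]
      exact zero_le
  have m3 : Measurable (fun x => ∫⁻ w, G x w ∂μ) := hGm.lintegral_prod_right'
  have m4 : Measurable (fun x => ∫⁻ w, G w x ∂μ) := hGm.lintegral_prod_left'
  have m5 : Measurable (fun x => ∫⁻ w, G w (x - h) ∂μ) := m4.comp (measurable_id.sub_const h)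
  have hm : Measurable (fun x => pairDiff D u x (x - h)) :=
    (measurable_pairDiff hD hu).comp (measurable_id.prodMk (measurable_id.sub_const h))
  calc v * shiftEnergy μ D u h = ∫⁻ x, v * pairDiff D u x (x - h) ∂μ := by
        rw [shiftEnergy, lintegral_const_mul _ hm]
    _ ≤ ∫⁻ x, 2 * ((∫⁻ w, G x w ∂μ) + ∫⁻ w, G w (x - h) ∂μ) ∂μ := lintegral_mono key
    _ = 2 * ((∫⁻ z in Z, shiftEnergy μ D u z ∂μ) + ∫⁻ z in Z, shiftEnergy μ D u z ∂μ) := by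
        rw [lintegral_const_mul' _ _ (by simp), lintegral_add_left m3, hGint,
          lintegral_sub_right_eq_self (fun x => ∫⁻ w, G w x ∂μ) h, lintegral_lintegral_swap, hGint]
        exact (hGm.comp measurable_swap).aemeasurable
    _ = 4 * ∫⁻ z in Z, shiftEnergy μ D u z ∂μ := by ring

end ShiftEnergy

/-! ### Intermediate points inside a ball. -/

section Corkscrew

variable {E : Type*} [NormedAddCommGroup E] [InnerProductSpace ℝ E]

/-- Move m towards the centre by δ, or to the centre itself if that is closer; this gains room δ
inside the ball. -/
lemma exists_dist_le_sub {x₀ m : E} {r δ : ℝ} (hm : m ∈ ball x₀ r) (hδ : 0 ≤ δ) (hδr : δ ≤ r) :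
    ∃ p : E, dist p m ≤ δ ∧ dist p x₀ ≤ r - δ := by
  rw [mem_ball, dist_eq_norm] at hm
  rcases le_or_gt ‖m - x₀‖ δ with h | h
  · exact ⟨x₀, by rwa [dist_comm, dist_eq_norm], by simpa using hδr⟩
  · have hpos : 0 < ‖m - x₀‖ := hδ.trans_lt h
    refine ⟨m - (δ / ‖m - x₀‖) • (m - x₀), ?_, ?_⟩
    · rw [dist_eq_norm, sub_sub_cancel_left, norm_neg, norm_smul, Real.norm_of_nonneg (by positivity),
        div_mul_cancel₀ _ hpos.ne']
    · have : m - (δ / ‖m - x₀‖) • (m - x₀) - x₀ = (1 - δ / ‖m - x₀‖) • (m - x₀) := by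
        rw [sub_smul, one_smul]; abel
      rw [dist_eq_norm, this, norm_smul, Real.norm_of_nonneg
        (sub_nonneg.2 ((div_le_one hpos).2 h.le)), sub_mul, div_mul_cancel₀ _ hpos.ne']
      linarith

/-- A ball of radius comparable to `|x - y|` that lies in the domain, near the midpoint. -/
lemma exists_ball_between {x₀ x y : E} {r : ℝ} (hx : x ∈ ball x₀ r) (hy : y ∈ ball x₀ r) :
    ∃ p : E, ∀ w ∈ ball p (‖x - y‖ / 8), w ∈ ball x₀ r ∧
      (‖x - y‖ / 4 ≤ ‖x - w‖ ∧ ‖x - w‖ < ‖x - y‖) ∧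
      (‖x - y‖ / 4 ≤ ‖w - y‖ ∧ ‖w - y‖ < ‖x - y‖) := by
  have hxy : ‖x - y‖ < 2 * r := by
    rw [← dist_eq_norm]
    have := dist_triangle_right x y x₀
    rw [mem_ball] at hx hy
    linarith
  have hm : midpoint ℝ x y ∈ ball x₀ r := (convex_ball x₀ r).midpoint_mem hx hy
  obtain ⟨p, hpm, hpx⟩ := exists_dist_le_sub (δ := ‖x - y‖ / 8) hm (by positivity)
    (by linarith [norm_nonneg (x - y)])
  refine ⟨p, fun w hw => ?_⟩
  rw [mem_ball] at hw
  have hwm : dist w (midpoint ℝ x y) < ‖x - y‖ / 4 := by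
    linarith [dist_triangle w p (midpoint ℝ x y)]
  have h1 : dist x (midpoint ℝ x y) = ‖x - y‖ / 2 := by
    rw [dist_left_midpoint, dist_eq_norm]
    norm_num; ring
  have h2 : dist y (midpoint ℝ x y) = ‖x - y‖ / 2 := by
    rw [dist_right_midpoint, dist_eq_norm]
    norm_num; ring
  have t1 := dist_triangle x w (midpoint ℝ x y)
  have t2 := dist_triangle_right x w (midpoint ℝ x y)
  have t3 := dist_triangle y w (midpoint ℝ x y)
  have t4 := dist_triangle_right y w (midpoint ℝ x y)
  rw [← dist_eq_norm x w, ← dist_eq_norm w y, dist_comm w y]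
  refine ⟨?_, ⟨by linarith, by linarith⟩, ⟨by linarith, by linarith⟩⟩
  rw [mem_ball]
  linarith [dist_triangle w p x₀]

/-- From each point of a ball, one of the two directions `z`, `-z` leads into the ball. -/
lemma exists_ball_shift {x₀ x z : E} {r ρ : ℝ} (hx : x ∈ ball x₀ r) (hρ : 0 < ρ) (hρr : ρ ≤ r)
    (hz : ‖z‖ ^ 2 ≤ ρ * r / 4) :
    ∃ p : E, ball p (ρ / 4) ⊆ ball x₀ r ∧
      (dist p (x + z) ≤ ρ / 2 ∨ dist p (x - z) ≤ ρ / 2) := by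
  obtain ⟨p, hpx, hp0⟩ := exists_dist_le_sub (δ := ρ / 2) hx (by positivity) (by linarith)
  have main : ∀ z' : E, ‖z'‖ = ‖z‖ → inner ℝ (p - x₀) z' ≤ 0 →
      ball (p + z') (ρ / 4) ⊆ ball x₀ r := by
    intro z' hz' hin
    refine ball_subset_ball' ?_
    -- The cross term is nonpositive by the choice of sign, and (r - ρ/2)² + ρr/4 ≤ (r - ρ/4)²
    -- because ρ ≤ r.
    have h1 : ‖p + z' - x₀‖ ^ 2 ≤ (r - ρ / 4) ^ 2 := by
      rw [add_sub_right_comm, norm_add_sq_real, hz']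
      rw [dist_eq_norm] at hp0
      have : ‖p - x₀‖ ^ 2 ≤ (r - ρ / 2) ^ 2 := by gcongr
      nlinarith
    have h2 := abs_le_of_sq_le_sq h1 (by linarith)
    rw [abs_of_nonneg (norm_nonneg _)] at h2
    rw [dist_eq_norm]
    linarith
  rcases le_total (inner ℝ (p - x₀) z) 0 with h | h
  · exact ⟨p + z, main z rfl h, Or.inl (by simpa using hpx)⟩
  · refine ⟨p + -z, main (-z) (norm_neg z) (by rw [inner_neg_right]; linarith), Or.inr ?_⟩
    rw [← sub_eq_add_neg, dist_sub_right]
    exact hpx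

end Corkscrew

/-! ### Abel summation in `ℝ≥0∞`. -/

section Sums

lemma ENNReal.tsum_ite_le (f : ℕ → ℝ≥0∞) (i : ℕ) :
    ∑' j, (if i ≤ j then f j else 0) = ∑' j, f (j + i) := by
  rw [← ENNReal.summable.sum_add_tsum_nat_add' (k := i)]
  rw [Finset.sum_eq_zero (fun j hj => if_neg (by simpa using hj)), zero_add]
  simp

/-- Comparison of a sum with a geometric sum for monotone coefficients (Abel summation). -/
lemma ENNReal.tsum_mul_le_of_monotone {V g : ℕ → ℝ≥0∞} (hg : Monotone g) {C q : ℝ≥0∞}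
    (hq : q < 1) (hV : ∀ i, ∑' j, V (j + i) ≤ C * q ^ i) :
    ∑' j, V j * g j ≤ C * ((1 - q) * ∑' j, q ^ j * g j) := by
  -- Increments of g, with the value before index 0 taken to be 0. Truncated subtraction is harmless
  -- because g is monotone.
  set δ : ℕ → ℝ≥0∞ := fun i => g i - (if i = 0 then 0 else g (i - 1)) with hδ
  have hsum : ∀ j, g j = ∑ i ∈ Finset.range (j + 1), δ i := by
    intro j
    induction j with
    | zero => simp [hδ]
    | succ j ih =>
      rw [Finset.sum_range_succ, ← ih]
      simp only [hδ, Nat.add_eq_zero_iff, one_ne_zero, and_false, if_false, Nat.add_sub_cancel]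
      exact (add_tsub_cancel_of_le (hg (Nat.le_succ j))).symm
  have hsum' : ∀ j, g j = ∑' i, (if i ≤ j then δ i else 0) := by
    intro j
    rw [tsum_eq_sum (s := Finset.range (j + 1)), hsum]
    · refine Finset.sum_congr rfl fun i hi => ?_
      rw [if_pos (Nat.lt_succ_iff.1 (Finset.mem_range.1 hi))]
    · intro i hi
      rw [if_neg]
      simpa [Nat.lt_succ_iff] using hi
  have swap : ∀ f : ℕ → ℝ≥0∞, ∑' j, f j * g j = ∑' i, δ i * ∑' j, f (j + i) := by
    intro f
    calc ∑' j, f j * g j = ∑' j, ∑' i, f j * (if i ≤ j then δ i else 0) := by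
          refine tsum_congr fun j => ?_
          rw [ENNReal.tsum_mul_left, ← hsum']
      _ = ∑' i, ∑' j, δ i * (if i ≤ j then f j else 0) := by
          rw [ENNReal.tsum_comm]
          refine tsum_congr fun i => tsum_congr fun j => ?_
          split_ifs <;> simp [mul_comm]
      _ = _ := by
          refine tsum_congr fun i => ?_
          rw [ENNReal.tsum_mul_left, ENNReal.tsum_ite_le]
  -- For the geometric sequence itself the tail hypothesis is an equality, up to the factor 1 - q;
  -- comparing tails increment by increment then suffices.
  have hgeo : ∀ i : ℕ, (1 - q) * ∑' j, q ^ (j + i) = q ^ i := by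
    intro i
    simp_rw [pow_add, ENNReal.tsum_mul_right, ENNReal.tsum_geometric]
    rw [← mul_assoc, ENNReal.mul_inv_cancel (tsub_pos_of_lt hq).ne'
      (ne_top_of_le_ne_top ENNReal.one_ne_top tsub_le_self), one_mul]
  rw [swap, swap, ← ENNReal.tsum_mul_left, ← ENNReal.tsum_mul_left]
  refine ENNReal.tsum_le_tsum fun i => ?_
  calc δ i * ∑' j, V (j + i) ≤ δ i * (C * q ^ i) := by gcongr; exact hV i
    _ = C * ((1 - q) * (δ i * ∑' j, q ^ (j + i))) := by
      rw [mul_left_comm (1 - q), hgeo]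
      ring

end Sums

/-! ### Decomposition into geometric shells. -/

section Shells

variable {E : Type*} [NormedAddCommGroup E]

/-- The shells `{s b^(n+1) < |z| ≤ s b^n}`. -/
def shell (E : Type*) [NormedAddCommGroup E] (s b : ℝ) (n : ℕ) : Set E :=
  {z | s * b ^ (n + 1) < ‖z‖ ∧ ‖z‖ ≤ s * b ^ n}

lemma measurableSet_shell [MeasurableSpace E] [BorelSpace E] (s b : ℝ) (n : ℕ) :
    MeasurableSet (shell E s b n) :=
  (measurableSet_lt measurable_const measurable_norm).inter
    (measurableSet_le measurable_norm measurable_const)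

lemma pairwise_disjoint_shell {s b : ℝ} (hs : 0 < s) (hb : 0 < b) (hb1 : b < 1) :
    Pairwise (Function.onFun Disjoint (shell E s b)) := by
  refine (pairwise_disjoint_on _).2 fun m n hmn => ?_
  refine Set.disjoint_left.2 fun z hz hz' => ?_
  have : s * b ^ n ≤ s * b ^ (m + 1) := by
    gcongr ?_ * ?_
    exact pow_le_pow_of_le_one hb.le hb1.le hmn
  exact absurd (hz.1.trans_le hz'.2) (not_lt.2 this)

lemma exists_mem_shell {s b : ℝ} (hs : 0 < s) (hb : 0 < b) (hb1 : b < 1) {z : E} (hz : z ≠ 0)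
    (hzs : ‖z‖ ≤ s) : ∃ n, z ∈ shell E s b n := by
  obtain ⟨n, h1, h2⟩ := exists_nat_pow_near_of_lt_one (div_pos (norm_pos_iff.2 hz) hs)
    ((div_le_one hs).2 hzs) hb hb1
  exact ⟨n, (lt_div_iff₀' hs).1 h1, (div_le_iff₀' hs).1 h2⟩

lemma shell_subset_closedBall {s b : ℝ} (hs : 0 ≤ s) (hb : 0 ≤ b) (hb1 : b ≤ 1) (n i : ℕ) :
    shell E s b (n + i) ⊆ closedBall 0 (s * b ^ i) := by
  intro z hz
  rw [mem_closedBall_zero_iff]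
  refine hz.2.trans ?_
  gcongr ?_ * ?_
  exact pow_le_pow_of_le_one hb hb1 (Nat.le_add_left i n)

variable [MeasurableSpace E] [BorelSpace E]

lemma tsum_setLIntegral_shell_le (μ : Measure E) {s b : ℝ} (hs : 0 < s) (hb : 0 < b) (hb1 : b < 1)
    (F : E → ℝ≥0∞) (i : ℕ) :
    ∑' n, ∫⁻ z in shell E s b (n + i), F z ∂μ ≤ ∫⁻ z in closedBall 0 (s * b ^ i), F z ∂μ := by
  rw [← lintegral_iUnion (fun n => measurableSet_shell s b (n + i))]
  · exact lintegral_mono_set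
      (iUnion_subset fun n => shell_subset_closedBall hs.le hb.le hb1.le n i)
  · exact fun m n hmn => pairwise_disjoint_shell hs hb hb1 (by simpa using hmn)

lemma lintegral_le_tsum_shell (μ : Measure E) {s b : ℝ} (hs : 0 < s) (hb : 0 < b) (hb1 : b < 1)
    {F : E → ℝ≥0∞} (h0 : F 0 = 0) (hF : ∀ z, s < ‖z‖ → F z = 0) :
    ∫⁻ z, F z ∂μ ≤ ∑' n, ∫⁻ z in shell E s b n, F z ∂μ := by
  calc ∫⁻ z, F z ∂μ ≤ ∫⁻ z, (⋃ n, shell E s b n).indicator F z ∂μ := by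
        refine lintegral_mono fun z => ?_
        by_cases hz : z ∈ ⋃ n, shell E s b n
        · rw [indicator_of_mem hz]
        · rw [indicator_of_notMem hz]
          by_cases hz0 : z = 0
          · rw [hz0, h0]
          · refine (hF z (lt_of_not_ge fun h => hz ?_)).le
            exact mem_iUnion.2 (exists_mem_shell hs hb hb1 hz0 h)
    _ ≤ ∫⁻ z in ⋃ n, shell E s b n, F z ∂μ := lintegral_indicator_le _ _
    _ ≤ _ := lintegral_iUnion_le _ _

end Shells

/-! ### Upper bound: integral control of U suffices. -/

section UpperBound

variable {E : Type*} [NormedAddCommGroup E] [InnerProductSpace ℝ E] [FiniteDimensional ℝ E]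
  [MeasurableSpace E] [BorelSpace E] {μ : Measure E} [μ.IsAddHaarMeasure]

open Module

lemma lintegral_comp_smul_eq {f : E → ℝ≥0∞} (hf : Measurable f) {t : ℝ} (ht : 0 < t) :
    ∫⁻ z, f z ∂μ = ENNReal.ofReal (t ^ finrank ℝ E) * ∫⁻ z, f (t • z) ∂μ := by
  rw [← lintegral_map hf (measurable_const_smul t), Measure.map_addHaar_smul μ ht.ne',
    lintegral_smul_measure, smul_eq_mul, ← mul_assoc, ← ENNReal.ofReal_mul (by positivity),
    abs_of_pos (by positivity), mul_inv_cancel₀ (by positivity), ENNReal.ofReal_one, one_mul]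

/-- Doubling maps shell j + 1 onto shell j with Jacobian 2^d, and doubling a shift costs a factor 4.
Hence the shell integrals times 2^((d+2)j) increase with j. -/
lemma setLIntegral_shell_shiftEnergy_le_succ {D : Set E} (hD : MeasurableSet D)
    (hc : Convex ℝ D) {u : E → ℝ} (hu : Measurable u) {s : ℝ} (j : ℕ) :
    ∫⁻ z in shell E s (1 / 2) j, shiftEnergy μ D u z ∂μ ≤
      2 ^ (finrank ℝ E + 2) * ∫⁻ z in shell E s (1 / 2) (j + 1), shiftEnergy μ D u z ∂μ := by
  have hm := measurable_shiftEnergy (μ := μ) hD hu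
  rw [← lintegral_indicator (measurableSet_shell _ _ _),
    ← lintegral_indicator (measurableSet_shell _ _ _),
    lintegral_comp_smul_eq (hm.indicator (measurableSet_shell _ _ _)) (two_pos),
    ENNReal.ofReal_pow (by norm_num), ENNReal.ofReal_ofNat, pow_add, mul_assoc]
  gcongr
  rw [← lintegral_const_mul' _ _ (by simp)]
  refine lintegral_mono fun z => ?_
  have hmem : (2 : ℝ) • z ∈ shell E s (1 / 2) j ↔ z ∈ shell E s (1 / 2) (j + 1) := by
    simp only [shell, mem_ofPred_eq, norm_smul, Real.norm_ofNat]
    constructor <;> rintro ⟨h1, h2⟩ <;> constructor <;> ring_nf at h1 h2 ⊢ <;> linarith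
  by_cases hz : z ∈ shell E s (1 / 2) (j + 1)
  · rw [indicator_of_mem hz, indicator_of_mem (hmem.2 hz)]
    exact_mod_cast shiftEnergy_natCast_smul_le hD hc hu z 2
  · rw [indicator_of_notMem (fun h => hz (hmem.1 h))]
    exact zero_le

/-- Average over the ball near the midpoint of x and x - h supplied by `exists_ball_between`. -/
lemma shiftEnergy_ball_le_average {x₀ h : E} {r : ℝ} {u : E → ℝ} (hu : Measurable u) :
    μ (ball 0 (‖h‖ / 8)) * shiftEnergy μ (ball x₀ r) u h ≤
      4 * ∫⁻ z in {z | ‖h‖ / 4 ≤ ‖z‖ ∧ ‖z‖ < ‖h‖}, shiftEnergy μ (ball x₀ r) u z ∂μ := by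
  refine mul_shiftEnergy_le measurableSet_ball hu ?_ fun x hx hxh => ?_
  · exact (measurableSet_le measurable_const measurable_norm).inter
      (measurableSet_lt measurable_norm measurable_const)
  · obtain ⟨p, hp⟩ := exists_ball_between hx hxh
    rw [sub_sub_cancel] at hp
    exact ⟨p, ‖h‖ / 8, by rw [Measure.addHaar_ball_center μ p], hp⟩

/-- Pointwise bound of `shiftEnergy` on a dyadic shell by its integral over a smaller shell. -/
lemma exists_shiftEnergy_le_shell (μ : Measure E) [μ.IsAddHaarMeasure] :
    ∃ M : ℝ≥0, ∀ (x₀ : E) (r : ℝ) (u : E → ℝ), Measurable u → ∀ j : ℕ,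
      ∀ h ∈ shell E 2 (1 / 2) j,
      4 ^ j * shiftEnergy μ (ball x₀ r) u h ≤ M * ((2 ^ (finrank ℝ E + 2)) ^ j *
        ∫⁻ z in shell E 2 (1 / 2) (j + 2), shiftEnergy μ (ball x₀ r) u z ∂μ) := by
  set N := finrank ℝ E
  set K : ℝ≥0∞ := 2 ^ (N + 2) with hK
  have hm0 : μ (ball (0 : E) (1 / 8)) ≠ 0 := (measure_ball_pos μ 0 (by norm_num)).ne'
  have hmt : μ (ball (0 : E) (1 / 8)) ≠ ⊤ := measure_ball_lt_top.ne
  set M : ℝ≥0∞ := (μ (ball (0 : E) (1 / 8)))⁻¹ * (4 * (K ^ 2 + K + 1)) with hM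
  have hKt : K ≠ ⊤ := by simp [hK]
  have hMt : M ≠ ⊤ := by
    refine ENNReal.mul_ne_top (ENNReal.inv_ne_top.2 hm0) ?_
    simp [ENNReal.mul_eq_top, hKt]
  refine ⟨M.toNNReal, fun x₀ r u hu j h hh => ?_⟩
  rw [ENNReal.coe_toNNReal hMt]
  set P : ℕ → ℝ≥0∞ := fun i => ∫⁻ z in shell E 2 (1 / 2) i, shiftEnergy μ (ball x₀ r) u z ∂μ
    with hP
  have hstep : ∀ i, P i ≤ K * P (i + 1) := fun i =>
    setLIntegral_shell_shiftEnergy_le_succ measurableSet_ball (convex_ball _ _) hu i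
  -- With h in shell j, lengths between |h|/4 and |h| can only meet the shells j, j + 1, j + 2.
  have hsub : {z : E | ‖h‖ / 4 ≤ ‖z‖ ∧ ‖z‖ < ‖h‖} ⊆
      (shell E 2 (1 / 2) j ∪ shell E 2 (1 / 2) (j + 1)) ∪ shell E 2 (1 / 2) (j + 2) := by
    rintro z ⟨h1, h2⟩
    obtain ⟨h3, h4⟩ := hh
    simp only [shell, mem_union, mem_ofPred_eq, pow_succ] at h3 h4 ⊢
    by_cases c1 : 2 * ((1 / 2 : ℝ) ^ j * (1 / 2)) < ‖z‖
    · exact Or.inl (Or.inl ⟨c1, by linarith⟩)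
    · by_cases c2 : 2 * ((1 / 2 : ℝ) ^ j * (1 / 2) * (1 / 2)) < ‖z‖
      · exact Or.inl (Or.inr ⟨c2, by linarith⟩)
      · exact Or.inr ⟨by linarith, by linarith⟩
  -- In shell j of outer scale 2 one has |h| > 2^(-j).
  have hvol : ((2 : ℝ≥0∞) ^ N) ^ j * μ (ball (0 : E) (‖h‖ / 8)) ≥ μ (ball (0 : E) (1 / 8)) := by
    have e1 : μ (ball (0 : E) ((1 / 2) ^ j * (1 / 8))) ≤ μ (ball (0 : E) (‖h‖ / 8)) := by
      refine measure_mono (ball_subset_ball ?_)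
      have := hh.1
      rw [pow_succ] at this
      linarith
    rw [Measure.addHaar_ball_mul_of_pos μ 0 (by positivity)] at e1
    refine le_trans (le_of_eq ?_) (mul_le_mul_right e1 _)
    rw [← mul_assoc]
    have : ((2 : ℝ≥0∞) ^ N) ^ j * ENNReal.ofReal (((1 / 2 : ℝ) ^ j) ^ N) = 1 := by
      rw [← ENNReal.ofReal_ofNat 2, ← ENNReal.ofReal_pow (by norm_num),
        ← ENNReal.ofReal_pow (by positivity), ← ENNReal.ofReal_mul (by positivity), ← pow_mul,
        ← pow_mul, mul_comm j N, ← mul_pow]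
      norm_num
    rw [this, one_mul]
  have h1 : μ (ball (0 : E) (‖h‖ / 8)) * shiftEnergy μ (ball x₀ r) u h ≤
      4 * (K ^ 2 + K + 1) * P (j + 2) := by
    calc _ ≤ 4 * ∫⁻ z in {z | ‖h‖ / 4 ≤ ‖z‖ ∧ ‖z‖ < ‖h‖}, shiftEnergy μ (ball x₀ r) u z ∂μ :=
          shiftEnergy_ball_le_average hu
      _ ≤ 4 * (P j + P (j + 1) + P (j + 2)) := by
          gcongr
          refine (lintegral_mono_set hsub).trans ((lintegral_union_le _ _ _).trans ?_)
          gcongr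
          exact lintegral_union_le _ _ _
      _ ≤ 4 * (K * (K * P (j + 2)) + K * P (j + 2) + P (j + 2)) := by
          gcongr
          · exact (hstep j).trans (by gcongr; exact hstep (j + 1))
          · exact hstep (j + 1)
      _ = _ := by ring
  have h2 : shiftEnergy μ (ball x₀ r) u h ≤ M * ((2 ^ N) ^ j * P (j + 2)) := by
    calc shiftEnergy μ (ball x₀ r) u h
        = (μ (ball (0 : E) (1 / 8)))⁻¹ * (μ (ball (0 : E) (1 / 8)) *
            shiftEnergy μ (ball x₀ r) u h) := by
          rw [← mul_assoc, ENNReal.inv_mul_cancel hm0 hmt, one_mul]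
      _ ≤ (μ (ball (0 : E) (1 / 8)))⁻¹ * ((((2 : ℝ≥0∞) ^ N) ^ j * μ (ball (0 : E) (‖h‖ / 8))) *
            shiftEnergy μ (ball x₀ r) u h) := by gcongr
      _ = (μ (ball (0 : E) (1 / 8)))⁻¹ * (((2 : ℝ≥0∞) ^ N) ^ j * (μ (ball (0 : E) (‖h‖ / 8)) *
            shiftEnergy μ (ball x₀ r) u h)) := by rw [mul_assoc ((2 ^ N) ^ j)]
      _ ≤ (μ (ball (0 : E) (1 / 8)))⁻¹ * (((2 : ℝ≥0∞) ^ N) ^ j *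
            (4 * (K ^ 2 + K + 1) * P (j + 2))) := by gcongr
      _ = _ := by rw [hM]; ring
  calc 4 ^ j * shiftEnergy μ (ball x₀ r) u h ≤ 4 ^ j * (M * ((2 ^ N) ^ j * P (j + 2))) := by gcongr
    _ = M * (K ^ j * P (j + 2)) := by
      rw [hK, pow_add, mul_pow]
      norm_num
      ring

/-- The weight of the Gagliardo form of order `α`. -/
noncomputable def gagliardoWeight (E : Type*) [NormedAddCommGroup E] [Module ℝ E] (α : ℝ) (z : E) :
    ℝ≥0∞ :=
  ENNReal.ofReal ((‖z‖ ^ ((finrank ℝ E : ℝ) + α))⁻¹)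

lemma measurable_gagliardoWeight (α : ℝ) : Measurable (gagliardoWeight E α) := by
  unfold gagliardoWeight
  fun_prop

/-- Produces the factor 2 - α that keeps the estimate uniform as α tends to 2. -/
lemma one_sub_two_rpow_le (x : ℝ) : 1 - (1 / 2 : ℝ) ^ x ≤ Real.log 2 * x := by
  have h := Real.add_one_le_exp (Real.log (1 / 2) * x)
  rw [Real.rpow_def_of_pos (by norm_num)]
  rw [one_div, Real.log_inv] at h ⊢
  linarith

/-- On shell j the shift energy is at most M 4^(-j) g j with g increasing, so the integral is at
most M ∑ V j * g j, where V j is the second moment of U on the shell. Abel summation replaces V j by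
(1 - q) q^j up to a constant, and q^j g j is dominated by the Gagliardo integral over shell j + 2.
-/
lemma exists_lintegral_shiftEnergy_mul_le (μ : Measure E) [μ.IsAddHaarMeasure] :
    ∃ M : ℝ≥0, ∀ (α : ℝ), 0 < α → α < 2 → ∀ (C : ℝ≥0∞) (U : E → ℝ≥0∞), Measurable U →
      (∀ r, 0 < r → r ≤ 2 → ∫⁻ z in closedBall 0 r, ENNReal.ofReal (‖z‖ ^ 2) * U z ∂μ ≤
        C * ENNReal.ofReal (r ^ (2 - α))) →
      ∀ (x₀ : E) (r : ℝ), r < 1 → ∀ u : E → ℝ, Measurable u →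
      ∫⁻ h, shiftEnergy μ (ball x₀ r) u h * U h ∂μ ≤
        M * C * (ENNReal.ofReal (2 - α) *
          ∫⁻ h, shiftEnergy μ (ball x₀ r) u h * gagliardoWeight E α h ∂μ) := by
  obtain ⟨M, hM⟩ := exists_shiftEnergy_le_shell μ
  refine ⟨4 * M, fun α hα0 hα2 C U hU hUC x₀ r hr u hu => ?_⟩
  set Φ := shiftEnergy μ (ball x₀ r) u with hΦ
  have hΦm : Measurable Φ := measurable_shiftEnergy measurableSet_ball hu
  set K : ℝ≥0∞ := 2 ^ (finrank ℝ E + 2) with hK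
  set g : ℕ → ℝ≥0∞ := fun j => K ^ j * ∫⁻ z in shell E 2 (1 / 2) (j + 2), Φ z ∂μ with hg
  set V : ℕ → ℝ≥0∞ := fun j => ∫⁻ z in shell E 2 (1 / 2) j, ENNReal.ofReal (‖z‖ ^ 2) * U z ∂μ
    with hV
  set q : ℝ≥0∞ := ENNReal.ofReal ((1 / 2 : ℝ) ^ (2 - α)) with hq
  have hq1 : q < 1 := by
    rw [hq, ENNReal.ofReal_lt_one]
    exact Real.rpow_lt_one (by norm_num) (by norm_num) (by linarith)
  have hmono : Monotone g := by
    refine monotone_nat_of_le_succ fun j => ?_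
    simp only [hg]
    rw [pow_succ, mul_assoc]
    gcongr
    exact setLIntegral_shell_shiftEnergy_le_succ measurableSet_ball (convex_ball _ _) hu (j + 2)
  have hVt : ∀ i, ∑' j, V (j + i) ≤ (4 * C) * q ^ i := by
    intro i
    have hr0 : (0 : ℝ) < 2 * (1 / 2) ^ i := by positivity
    have hr2 : (2 : ℝ) * (1 / 2) ^ i ≤ 2 := by
      linarith [pow_le_one₀ (n := i) (by norm_num : (0 : ℝ) ≤ 1 / 2) (by norm_num)]
    refine (tsum_setLIntegral_shell_le μ two_pos (by norm_num) (by norm_num) _ i).trans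
      ((hUC _ hr0 hr2).trans ?_)
    have e1 : (2 * (1 / 2 : ℝ) ^ i) ^ (2 - α) ≤ 4 * ((1 / 2 : ℝ) ^ (2 - α)) ^ i := by
      rw [Real.mul_rpow (by norm_num) (by positivity), ← Real.rpow_natCast, ← Real.rpow_natCast,
        ← Real.rpow_mul (by norm_num), ← Real.rpow_mul (by norm_num), mul_comm (2 - α)]
      gcongr
      calc (2 : ℝ) ^ (2 - α) ≤ 2 ^ (2 : ℝ) :=
            Real.rpow_le_rpow_of_exponent_le (by norm_num) (by linarith)
        _ = 4 := by norm_num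
    calc C * ENNReal.ofReal ((2 * (1 / 2 : ℝ) ^ i) ^ (2 - α))
        ≤ C * ENNReal.ofReal (4 * ((1 / 2 : ℝ) ^ (2 - α)) ^ i) := by gcongr
      _ = (4 * C) * q ^ i := by
        rw [ENNReal.ofReal_mul (by norm_num), ENNReal.ofReal_pow (by positivity),
          ENNReal.ofReal_ofNat]
        ring
  have hterm : ∀ j, ∫⁻ z in shell E 2 (1 / 2) j, Φ z * U z ∂μ ≤ M * (V j * g j) := by
    intro j
    have hmU : Measurable fun z : E => ENNReal.ofReal (‖z‖ ^ 2) * U z := by fun_prop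
    calc ∫⁻ z in shell E 2 (1 / 2) j, Φ z * U z ∂μ
        ≤ ∫⁻ z in shell E 2 (1 / 2) j, (M * g j) * (ENNReal.ofReal (‖z‖ ^ 2) * U z) ∂μ := by
          refine setLIntegral_mono' (measurableSet_shell _ _ _) fun z hz => ?_
          have h1 : (1 : ℝ≥0∞) ≤ 4 ^ j * ENNReal.ofReal (‖z‖ ^ 2) := by
            rw [← ENNReal.ofReal_ofNat 4, ← ENNReal.ofReal_pow (by norm_num),
              ← ENNReal.ofReal_mul (by positivity), ENNReal.one_le_ofReal]
            have h2 : (1 / 2 : ℝ) ^ j ≤ ‖z‖ := by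
              have := hz.1
              rw [pow_succ] at this
              linarith
            calc (1 : ℝ) = 4 ^ j * ((1 / 2) ^ j) ^ 2 := by
                  rw [← pow_mul, mul_comm j 2, pow_mul, ← mul_pow]
                  norm_num
              _ ≤ 4 ^ j * ‖z‖ ^ 2 := by gcongr
          calc Φ z * U z ≤ (4 ^ j * ENNReal.ofReal (‖z‖ ^ 2)) * (Φ z * U z) :=
                le_mul_of_one_le_left' h1
            _ = (4 ^ j * Φ z) * (ENNReal.ofReal (‖z‖ ^ 2) * U z) := by ring
            _ ≤ _ := mul_le_mul' (hM x₀ r u hu j z hz) le_rfl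
      _ = M * (V j * g j) := by
        rw [lintegral_const_mul _ hmU]
        simp only [hV]
        ring
  -- The exponents match: q^j 2^((d+2)j) = 2^(j(d+α)), while |z| ≤ 2^(-j) on shell j + 2.
  have hlow : ∀ j, q ^ j * g j ≤
      ∫⁻ z in shell E 2 (1 / 2) (j + 2), Φ z * gagliardoWeight E α z ∂μ := by
    intro j
    simp only [hg]
    rw [← mul_assoc, ← lintegral_const_mul _ hΦm]
    refine setLIntegral_mono' (measurableSet_shell _ _ _) fun z hz => ?_
    rw [mul_comm (Φ z)]
    gcongr
    rw [hq, hK, gagliardoWeight, ← ENNReal.ofReal_ofNat 2, ← ENNReal.ofReal_pow (by positivity),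
      ← ENNReal.ofReal_pow (by positivity), ← ENNReal.ofReal_pow (by positivity),
      ← ENNReal.ofReal_mul (by positivity)]
    refine ENNReal.ofReal_le_ofReal ?_
    have hzpos : 0 < ‖z‖ := lt_trans (by positivity) hz.1
    have hzle : ‖z‖ ≤ (1 / 2 : ℝ) ^ j := by
      refine hz.2.trans ?_
      rw [pow_add]
      have : (0 : ℝ) < (1 / 2) ^ j := by positivity
      linarith
    have hexp : (0 : ℝ) ≤ (finrank ℝ E : ℝ) + α := by positivity
    calc ((1 / 2 : ℝ) ^ (2 - α)) ^ j * (2 ^ (finrank ℝ E + 2)) ^ j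
        = (((1 / 2 : ℝ) ^ j) ^ ((finrank ℝ E : ℝ) + α))⁻¹ := by
          rw [← mul_pow, ← Real.rpow_natCast ((1 / 2 : ℝ)) j, ← Real.rpow_mul (by norm_num),
            mul_comm (j : ℝ), Real.rpow_mul (by norm_num), Real.rpow_natCast, ← inv_pow]
          congr 1
          rw [← Real.rpow_natCast, one_div, Real.inv_rpow (by norm_num),
            Real.inv_rpow (by norm_num), inv_inv, ← Real.rpow_neg (by norm_num),
            ← Real.rpow_add (by norm_num)]
          congr 1
          push_cast
          ring
      _ ≤ _ := by gcongr
  have hq2 : 1 - q ≤ ENNReal.ofReal (2 - α) := by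
    rw [hq, ← ENNReal.ofReal_one, ← ENNReal.ofReal_sub _ (by positivity)]
    refine ENNReal.ofReal_le_ofReal ((one_sub_two_rpow_le _).trans ?_)
    have := Real.log_two_lt_d9
    nlinarith
  calc ∫⁻ h, Φ h * U h ∂μ ≤ ∑' j, ∫⁻ z in shell E 2 (1 / 2) j, Φ z * U z ∂μ := by
        refine lintegral_le_tsum_shell μ two_pos (by norm_num) (by norm_num) ?_ fun z hz => ?_
        · rw [hΦ, shiftEnergy_zero, zero_mul]
        · rw [hΦ, shiftEnergy_eq_zero_of_le_norm u (by linarith), zero_mul]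
    _ ≤ ∑' j, M * (V j * g j) := ENNReal.tsum_le_tsum hterm
    _ = M * ∑' j, V j * g j := ENNReal.tsum_mul_left
    _ ≤ M * ((4 * C) * ((1 - q) * ∑' j, q ^ j * g j)) := by
        gcongr
        exact ENNReal.tsum_mul_le_of_monotone hmono hq1 hVt
    _ ≤ M * ((4 * C) * (ENNReal.ofReal (2 - α) * ∫⁻ h, Φ h * gagliardoWeight E α h ∂μ)) := by
        gcongr
        refine (ENNReal.tsum_le_tsum hlow).trans ((tsum_setLIntegral_shell_le μ two_pos
          (by norm_num) (by norm_num) _ 2).trans (setLIntegral_le_lintegral _ _))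
    _ = _ := by
        push_cast
        ring

end UpperBound

/-! ### Lower bound: shifts in one small ball per annulus control all shifts. -/

section LowerBound

variable {E : Type*} [NormedAddCommGroup E] [InnerProductSpace ℝ E] [FiniteDimensional ℝ E]
  [MeasurableSpace E] [BorelSpace E] {μ : Measure E} [μ.IsAddHaarMeasure]

open Module

lemma setLIntegral_ball_neg_shiftEnergy (D : Set E) (u : E → ℝ) (z : E) (ρ : ℝ) :
    ∫⁻ w in ball (-z) ρ, shiftEnergy μ D u w ∂μ = ∫⁻ w in ball z ρ, shiftEnergy μ D u w ∂μ := by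
  rw [← lintegral_indicator measurableSet_ball, ← lintegral_indicator measurableSet_ball,
    ← lintegral_neg_eq_self]
  refine lintegral_congr fun w => ?_
  have : -w ∈ ball (-z) ρ ↔ w ∈ ball z ρ := by
    rw [mem_ball, mem_ball, dist_neg_neg]
  by_cases hw : w ∈ ball z ρ
  · rw [indicator_of_mem hw, indicator_of_mem (this.2 hw), shiftEnergy_neg]
  · rw [indicator_of_notMem hw, indicator_of_notMem (fun h => hw (this.1 h))]

/-- Go from x to x - h through points w close to x + z or x - z: x - w is then near ∓z and w - (x -
h) near ±z. Evenness of `shiftEnergy` identifies the two balls, whence 8 = 4 · 2. -/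
lemma shiftEnergy_le_setLIntegral_ball {x₀ z h : E} {r ρ : ℝ} {u : E → ℝ} (hu : Measurable u)
    (hρ : 0 < ρ) (hρr : ρ ≤ r) (hz : ‖z‖ ^ 2 ≤ ρ * r / 4) (hh : ‖h‖ ≤ ρ / 4) :
    μ (ball 0 (ρ / 4)) * shiftEnergy μ (ball x₀ r) u h ≤
      8 * ∫⁻ w in ball z ρ, shiftEnergy μ (ball x₀ r) u w ∂μ := by
  have h1 : μ (ball 0 (ρ / 4)) * shiftEnergy μ (ball x₀ r) u h ≤
      4 * ∫⁻ w in ball z ρ ∪ ball (-z) ρ, shiftEnergy μ (ball x₀ r) u w ∂μ := by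
    refine mul_shiftEnergy_le measurableSet_ball hu (measurableSet_ball.union measurableSet_ball)
      fun x hx _ => ?_
    obtain ⟨p, hp, hd⟩ := exists_ball_shift hx hρ hρr hz
    refine ⟨p, ρ / 4, by rw [Measure.addHaar_ball_center μ p], fun w hw => ⟨hp hw, ?_⟩⟩
    rw [mem_ball] at hw
    rcases hd with hd | hd
    · have h2 : dist w (x + z) < 3 * ρ / 4 := by linarith [dist_triangle w p (x + z)]
      rw [dist_eq_norm] at h2
      constructor
      · refine Or.inr ?_
        rw [mem_ball, dist_eq_norm, ← norm_neg]
        have : -(x - w - -z) = w - (x + z) := by abel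
        rw [this]
        linarith
      · refine Or.inl ?_
        rw [mem_ball, dist_eq_norm]
        have : w - (x - h) - z = (w - (x + z)) + h := by abel
        rw [this]
        linarith [norm_add_le (w - (x + z)) h]
    · have h2 : dist w (x - z) < 3 * ρ / 4 := by linarith [dist_triangle w p (x - z)]
      rw [dist_eq_norm] at h2
      constructor
      · refine Or.inl ?_
        rw [mem_ball, dist_eq_norm, ← norm_neg]
        have : -(x - w - z) = w - (x - z) := by abel
        rw [this]
        linarith
      · refine Or.inr ?_
        rw [mem_ball, dist_eq_norm]
        have : w - (x - h) - -z = (w - (x - z)) + h := by abel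
        rw [this]
        linarith [norm_add_le (w - (x - z)) h]
  calc _ ≤ 4 * ∫⁻ w in ball z ρ ∪ ball (-z) ρ, shiftEnergy μ (ball x₀ r) u w ∂μ := h1
    _ ≤ 4 * ((∫⁻ w in ball z ρ, shiftEnergy μ (ball x₀ r) u w ∂μ) +
          ∫⁻ w in ball (-z) ρ, shiftEnergy μ (ball x₀ r) u w ∂μ) := by
        gcongr
        exact lintegral_union_le _ _ _
    _ = _ := by rw [setLIntegral_ball_neg_shiftEnergy]; ring

lemma gagliardoWeight_anti {α : ℝ} (hα : 0 ≤ α) {z w : E} (hz : z ≠ 0) (h : ‖z‖ ≤ ‖w‖) :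
    gagliardoWeight E α w ≤ gagliardoWeight E α z := by
  unfold gagliardoWeight
  have := norm_pos_iff.2 hz
  gcongr

/-- On convex sets the energy is controlled by its restriction to small shifts. -/
lemma lintegral_shiftEnergy_mul_weight_le {α : ℝ} (hα : 0 ≤ α) {x₀ : E} {r ε : ℝ}
    {u : E → ℝ} (hu : Measurable u) {N : ℕ} (hN : 0 < N) (hNε : 2 * r ≤ N * ε) :
    ∫⁻ h, shiftEnergy μ (ball x₀ r) u h * gagliardoWeight E α h ∂μ ≤
      (N : ℝ≥0∞) ^ (finrank ℝ E + 2) *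
        ∫⁻ h in ball 0 ε, shiftEnergy μ (ball x₀ r) u h * gagliardoWeight E α h ∂μ := by
  have hN' : (1 : ℝ) ≤ N := by exact_mod_cast hN
  have hN0 : (0 : ℝ) < N := by linarith
  have hm := measurable_shiftEnergy (μ := μ) (measurableSet_ball (x := x₀) (ε := r)) hu
  have hm' : Measurable fun h => shiftEnergy μ (ball x₀ r) u h * gagliardoWeight E α h :=
    hm.mul (measurable_gagliardoWeight α)
  -- Rescaling by N costs N^d, the shift energy costs N², and the weight decreases. If |h| ≥ ε, then
  -- |Nh| ≥ 2r and the shift energy vanishes.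
  rw [lintegral_comp_smul_eq hm' hN0,
    ENNReal.ofReal_pow hN0.le, ENNReal.ofReal_natCast, pow_add, mul_assoc]
  gcongr
  rw [← lintegral_const_mul' _ _ (by simp), ← lintegral_indicator measurableSet_ball]
  refine lintegral_mono fun h => ?_
  by_cases hh : h ∈ ball 0 ε
  · rw [indicator_of_mem hh]
    rcases eq_or_ne h 0 with rfl | h0
    · simp [shiftEnergy_zero]
    · rw [← mul_assoc]
      refine mul_le_mul' (shiftEnergy_natCast_smul_le measurableSet_ball (convex_ball _ _) hu h N)
        (gagliardoWeight_anti hα h0 ?_)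
      rw [norm_smul, Real.norm_of_nonneg hN0.le]
      exact le_mul_of_one_le_left (norm_nonneg h) hN'
  · rw [indicator_of_notMem hh, shiftEnergy_eq_zero_of_le_norm, zero_mul]
    rw [mem_ball_zero_iff, not_lt] at hh
    rw [norm_smul, Real.norm_of_nonneg hN0.le]
    exact hNε.trans (by gcongr)

/-- The outer radius c b^n / 4 of the shell is a quarter of the radius of the n-th ball, as
`shiftEnergy_le_setLIntegral_ball` requires. The weights on shell and ball are comparable, and the
volume of the shell cancels the averaging volume. -/
lemma setLIntegral_shell_inter_le {b c : ℝ} (hb : 0 < b) (hb1 : b < 1) (hc : 0 < c) (hc1 : c ≤ 1)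
    {α : ℝ} (hα0 : 0 < α) (hα2 : α < 2) {n : ℕ} {z : E}
    (hz : ∀ w ∈ ball z (c * b ^ n), b ^ n ≤ ‖w‖ ∧ ‖w‖ < b ^ n / b) (x₀ : E) {r : ℝ}
    (hr0 : 0 < r) {u : E → ℝ} (hu : Measurable u) :
    ∫⁻ h in shell E (c / 4) b n, (ball 0 (c ^ 2 * b ^ 3 / 16 * r)).indicator
        (fun h => shiftEnergy μ (ball x₀ r) u h * gagliardoWeight E α h) h ∂μ ≤
      ENNReal.ofReal (8 * (4 / (c * b ^ 2)) ^ (finrank ℝ E + 2)) *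
        ∫⁻ w in ball z (c * b ^ n), shiftEnergy μ (ball x₀ r) u w * gagliardoWeight E α w ∂μ := by
  set Φ := shiftEnergy μ (ball x₀ r) u with hΦ
  have hΦm : Measurable Φ := measurable_shiftEnergy measurableSet_ball hu
  set Λ : ℝ := (4 / (c * b ^ 2)) ^ (finrank ℝ E + 2) with hΛ
  set S := ∫⁻ w in ball z (c * b ^ n), Φ w * gagliardoWeight E α w ∂μ with hS
  have hbn : 0 < b ^ n := by positivity
  have hρ : 0 < c * b ^ n := by positivity
  set v := μ (ball (0 : E) (c * b ^ n / 4)) with hv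
  have hv0 : v ≠ 0 := (measure_ball_pos μ 0 (by positivity)).ne'
  have hvt : v ≠ ⊤ := measure_ball_lt_top.ne
  have hθ : 0 ≤ (finrank ℝ E : ℝ) + α := by positivity
  have hcb : 1 ≤ 4 / (c * b ^ 2) := by
    rw [one_le_div (by positivity)]
    nlinarith [pow_le_one₀ (n := 2) hb.le hb1.le, pow_pos hb 2]
  have hΛ1 : (4 / (c * b ^ 2)) ^ ((finrank ℝ E : ℝ) + α) ≤ Λ := by
    rw [hΛ, ← Real.rpow_natCast (4 / (c * b ^ 2))]
    refine Real.rpow_le_rpow_of_exponent_le hcb ?_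
    push_cast
    linarith
  have hpt : ∀ h ∈ shell E (c / 4) b n, (ball 0 (c ^ 2 * b ^ 3 / 16 * r)).indicator
      (fun h => Φ h * gagliardoWeight E α h) h ≤ v⁻¹ * (ENNReal.ofReal (8 * Λ) * S) := by
    intro h hh
    by_cases hb0 : h ∈ ball 0 (c ^ 2 * b ^ 3 / 16 * r)
    swap
    · rw [indicator_of_notMem hb0]
      exact zero_le
    rw [indicator_of_mem hb0]
    rw [mem_ball_zero_iff] at hb0
    -- From c b^(n+1) / 4 < |h| < c² b³ r / 16. This yields both ρ ≤ r and |z|² ≤ ρr/4 for ρ = c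
    -- b^n, so that one of ±z leads into the domain.
    have hsmall : b ^ n < c * b ^ 2 * r / 4 := by
      have h1 : c * b / 4 * b ^ n < c * b / 4 * (c * b ^ 2 * r / 4) := by
        have := hh.1.trans hb0
        rw [pow_succ] at this
        nlinarith
      exact lt_of_mul_lt_mul_left h1 (by positivity)
    have hb2 : b ^ 2 ≤ 1 := pow_le_one₀ hb.le hb1.le
    have hρr : c * b ^ n ≤ r := by
      have h1 : c * b ^ n ≤ 1 * b ^ n := by gcongr
      have h2 : c * b ^ 2 * r ≤ 1 * 1 * r := by gcongr
      linarith
    have hzn : ‖z‖ ^ 2 ≤ c * b ^ n * r / 4 := by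
      have h1 := (hz z (mem_ball_self hρ)).2
      calc ‖z‖ ^ 2 ≤ (b ^ n / b) ^ 2 := by gcongr
        _ = b ^ n * b ^ n / b ^ 2 := by rw [div_pow, sq (b ^ n)]
        _ ≤ b ^ n * (c * b ^ 2 * r / 4) / b ^ 2 := by gcongr
        _ = c * b ^ n * r / 4 := by field_simp
    have h1 := shiftEnergy_le_setLIntegral_ball (μ := μ) (x₀ := x₀) (h := h) hu hρ hρr hzn
      (by linarith [hh.2])
    rw [← hΦ, ← hv] at h1
    have h2 : gagliardoWeight E α h * ∫⁻ w in ball z (c * b ^ n), Φ w ∂μ ≤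
        ENNReal.ofReal Λ * S := by
      rw [hS, ← lintegral_const_mul _ hΦm, ← lintegral_const_mul' _ _ (by simp)]
      refine setLIntegral_mono' measurableSet_ball fun w hw => ?_
      rw [mul_left_comm, mul_comm _ (Φ w)]
      gcongr
      obtain ⟨hw1, hw2⟩ := hz w hw
      have hwpos : 0 < ‖w‖ := hbn.trans_le hw1
      have hhpos : 0 < ‖h‖ := lt_of_lt_of_le (by positivity) hh.1.le
      unfold gagliardoWeight
      rw [← ENNReal.ofReal_mul (by positivity)]
      refine ENNReal.ofReal_le_ofReal ?_
      rw [inv_le_iff_one_le_mul₀ (by positivity), mul_right_comm,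
        le_mul_inv_iff₀ (by positivity), one_mul]
      calc ‖w‖ ^ ((finrank ℝ E : ℝ) + α)
          ≤ (4 / (c * b ^ 2) * ‖h‖) ^ ((finrank ℝ E : ℝ) + α) := by
            gcongr
            refine hw2.le.trans ?_
            calc b ^ n / b = 4 / (c * b ^ 2) * (c / 4 * b ^ (n + 1)) := by
                  field_simp
                  rw [pow_succ]
              _ ≤ _ := by gcongr; exact hh.1.le
        _ = (4 / (c * b ^ 2)) ^ ((finrank ℝ E : ℝ) + α) * ‖h‖ ^ ((finrank ℝ E : ℝ) + α) :=
            Real.mul_rpow (by positivity) (by positivity)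
        _ ≤ _ := by gcongr
    calc Φ h * gagliardoWeight E α h = v⁻¹ * ((v * Φ h) * gagliardoWeight E α h) := by
          rw [mul_assoc v, ← mul_assoc, ENNReal.inv_mul_cancel hv0 hvt, one_mul]
      _ ≤ v⁻¹ * ((8 * ∫⁻ w in ball z (c * b ^ n), Φ w ∂μ) * gagliardoWeight E α h) := by gcongr
      _ = v⁻¹ * (8 * (gagliardoWeight E α h * ∫⁻ w in ball z (c * b ^ n), Φ w ∂μ)) := by ring
      _ ≤ v⁻¹ * (8 * (ENNReal.ofReal Λ * S)) := by gcongr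
      _ = _ := by rw [ENNReal.ofReal_mul (by norm_num), ENNReal.ofReal_ofNat, mul_assoc]
  calc _ ≤ ∫⁻ h in shell E (c / 4) b n, v⁻¹ * (ENNReal.ofReal (8 * Λ) * S) ∂μ :=
        setLIntegral_mono' (measurableSet_shell _ _ _) hpt
    _ = v⁻¹ * (ENNReal.ofReal (8 * Λ) * S) * μ (shell E (c / 4) b n) := setLIntegral_const _ _
    _ ≤ v⁻¹ * (ENNReal.ofReal (8 * Λ) * S) * v := by
        gcongr
        calc μ (shell E (c / 4) b n) ≤ μ (closedBall 0 (c / 4 * b ^ n)) :=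
              measure_mono fun h hh => by rw [mem_closedBall_zero_iff]; exact hh.2
          _ = v := by
            rw [hv, div_mul_eq_mul_div, Measure.addHaar_closedBall μ 0 (by positivity),
              ← Measure.addHaar_ball_of_pos μ 0 (by positivity)]
    _ = _ := by
        rw [mul_comm, ← mul_assoc, ENNReal.mul_inv_cancel hv0 hvt, one_mul]

lemma exists_lintegral_shiftEnergy_weight_le (E : Type*) [NormedAddCommGroup E]
    [InnerProductSpace ℝ E] [FiniteDimensional ℝ E] [MeasurableSpace E] [BorelSpace E]
    {b c : ℝ} (hb : 0 < b) (hb1 : b < 1) (hc : 0 < c) (hc1 : c ≤ 1) :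
    ∃ M : ℝ, 0 < M ∧ ∀ (μ : Measure E) [μ.IsAddHaarMeasure] (α : ℝ), 0 < α → α < 2 →
      ∀ z : ℕ → E, (∀ n, ∀ w ∈ ball (z n) (c * b ^ n), b ^ n ≤ ‖w‖ ∧ ‖w‖ < b ^ n / b) →
      ∀ (x₀ : E) (r : ℝ), 0 < r → r < 1 → ∀ u : E → ℝ, Measurable u →
      ∫⁻ h, shiftEnergy μ (ball x₀ r) u h * gagliardoWeight E α h ∂μ ≤
        ENNReal.ofReal M * ∫⁻ h in ⋃ n, ball (z n) (c * b ^ n),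
          shiftEnergy μ (ball x₀ r) u h * gagliardoWeight E α h ∂μ := by
  set ε : ℝ := c ^ 2 * b ^ 3 / 16 with hε
  have hε0 : 0 < ε := by positivity
  have hεc : ε ≤ c / 4 := by
    have h1 : c ^ 2 ≤ c := by nlinarith
    have h2 : b ^ 3 ≤ 1 := pow_le_one₀ hb.le hb1.le
    have h3 : c ^ 2 * b ^ 3 ≤ c * 1 := by gcongr
    rw [hε]
    linarith
  -- N is chosen so that N ε r ≥ 2r, the diameter bound for shifts.
  obtain ⟨N, hN⟩ := exists_nat_gt (2 / ε)
  have hN0 : (0 : ℝ) < N := lt_trans (by positivity) hN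
  have hN1 : 0 < N := by exact_mod_cast hN0
  rw [div_lt_iff₀ hε0] at hN
  set Λ : ℝ := 8 * (4 / (c * b ^ 2)) ^ (finrank ℝ E + 2) with hΛ
  refine ⟨N ^ (finrank ℝ E + 2) * Λ, by positivity, ?_⟩
  intro μ _ α hα0 hα2 z hz x₀ r hr0 hr1 u hu
  set F : E → ℝ≥0∞ := fun h => shiftEnergy μ (ball x₀ r) u h * gagliardoWeight E α h with hF
  -- The balls lie in the disjoint annuli b^n ≤ |w| < b^(n-1), so summing over n counts nothing
  -- twice.
  have hdisj : Pairwise (Function.onFun Disjoint fun n => ball (z n) (c * b ^ n)) := by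
    refine (pairwise_disjoint_on _).2 fun m n hmn => Set.disjoint_left.2 fun w hw hw' => ?_
    have h1 := (hz m w hw).1
    have h2 := (hz n w hw').2
    have h3 : b ^ n / b ≤ b ^ m := by
      rw [div_le_iff₀ hb, ← pow_succ]
      exact pow_le_pow_of_le_one hb.le hb1.le hmn
    linarith
  calc ∫⁻ h, F h ∂μ ≤ (N : ℝ≥0∞) ^ (finrank ℝ E + 2) * ∫⁻ h in ball 0 (ε * r), F h ∂μ :=
        lintegral_shiftEnergy_mul_weight_le hα0.le hu hN1 (by nlinarith)
    _ ≤ (N : ℝ≥0∞) ^ (finrank ℝ E + 2) * ∑' n, ∫⁻ h in shell E (c / 4) b n,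
          (ball 0 (ε * r)).indicator F h ∂μ := by
        gcongr
        rw [← lintegral_indicator measurableSet_ball]
        refine lintegral_le_tsum_shell μ (by positivity) hb hb1 ?_ fun w hw => ?_
        · by_cases h0 : (0 : E) ∈ ball 0 (ε * r)
          · rw [indicator_of_mem h0]
            simp [hF, shiftEnergy_zero]
          · rw [indicator_of_notMem h0]
        · refine indicator_of_notMem ?_ _
          rw [mem_ball_zero_iff, not_lt]
          nlinarith
    _ ≤ (N : ℝ≥0∞) ^ (finrank ℝ E + 2) * ∑' n, ENNReal.ofReal Λ *
          ∫⁻ w in ball (z n) (c * b ^ n), F w ∂μ := by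
        gcongr with n
        exact setLIntegral_shell_inter_le hb hb1 hc hc1 hα0 hα2 (hz n) x₀ hr0 hu
    _ = _ := by
        rw [ENNReal.tsum_mul_left, lintegral_iUnion (fun n => measurableSet_ball) hdisj,
          ENNReal.ofReal_mul (p := (N : ℝ) ^ (finrank ℝ E + 2)) (by positivity),
          ENNReal.ofReal_pow hN0.le, ENNReal.ofReal_natCast,
          mul_assoc]

end LowerBound

/-! ### From kernels to weights. -/

section Kernels

variable {d : ℕ} {k : EuclideanSpace ℝ (Fin d) → EuclideanSpace ℝ (Fin d) → ℝ≥0}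
  {L U U' : EuclideanSpace ℝ (Fin d) → ℝ≥0} {α C₀ C₁ : ℝ}

/-- U is only almost everywhere measurable; this and the next lemma allow passing to a Borel
representative. -/
lemma ConditionU0.congr_ae (h : ConditionU0 C₀ U) (hU : U =ᵐ[volume] U') : ConditionU0 C₀ U' := by
  unfold ConditionU0 at h ⊢
  refine le_of_eq_of_le (lintegral_congr_ae ?_) h
  filter_upwards [hU] with z hz
  rw [hz]

lemma ConditionU1.congr_ae (h : ConditionU1 α C₁ U) (hU : U =ᵐ[volume] U') :
    ConditionU1 α C₁ U' := by
  intro r hr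
  refine le_of_eq_of_le (lintegral_congr_ae ?_) (h r hr)
  filter_upwards [ae_restrict_of_ae hU] with z hz
  rw [hz]

/-- (U0) and (U1) combined into one bound valid at all scales. -/
lemma setLIntegral_ball_min_mul_le (hα : α < 2) (hC₀ : 0 < C₀) (h0 : ConditionU0 C₀ U)
    (h1 : ConditionU1 α C₁ U) {r : ℝ} (hr : 0 < r) :
    ∫⁻ z in ball 0 r, ENNReal.ofReal (min (‖z‖ ^ 2) 1) * (U z : ℝ≥0∞) ≤
      ENNReal.ofReal (max C₀ C₁ * r ^ (2 - α)) := by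
  rcases lt_or_ge r 1 with hr1 | hr1
  · calc _ ≤ ∫⁻ z in ball 0 r, ENNReal.ofReal (‖z‖ ^ 2) * (U z : ℝ≥0∞) := by
          refine lintegral_mono fun z => ?_
          gcongr
          exact min_le_left _ _
      _ ≤ ENNReal.ofReal (C₁ * r ^ (2 - α)) := h1 r ⟨hr, hr1⟩
      _ ≤ _ := by
          gcongr
          exact le_max_right _ _
  · refine (setLIntegral_le_lintegral _ _).trans (h0.trans (ENNReal.ofReal_le_ofReal ?_))
    have h2 : 1 ≤ r ^ (2 - α) := Real.one_le_rpow hr1 (by linarith)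
    nlinarith [le_max_left C₀ C₁]

lemma two_mul_rpow_le (hα0 : 0 < α) {r : ℝ} (hr : 0 < r) :
    (2 * r) ^ (2 - α) ≤ 4 * r ^ (2 - α) := by
  rw [Real.mul_rpow (by norm_num) hr.le]
  gcongr
  calc (2 : ℝ) ^ (2 - α) ≤ 2 ^ (2 : ℝ) :=
        Real.rpow_le_rpow_of_exponent_le (by norm_num) (by linarith)
    _ = 4 := by norm_num

/-- Extends (U1) to radii up to 2, the bound for shifts within a ball of radius less than 1, using
|z|² ≤ 4 min(|z|², 1) there. -/
lemma setLIntegral_closedBall_sq_mul_le (hα0 : 0 < α) (hα : α < 2) (hC₀ : 0 < C₀)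
    (h0 : ConditionU0 C₀ U) (h1 : ConditionU1 α C₁ U) {r : ℝ} (hr : 0 < r) (hr2 : r ≤ 2) :
    ∫⁻ z in closedBall 0 r, ENNReal.ofReal (‖z‖ ^ 2) * (U z : ℝ≥0∞) ≤
      ENNReal.ofReal (16 * max C₀ C₁) * ENNReal.ofReal (r ^ (2 - α)) := by
  have hmax : 0 < max C₀ C₁ := lt_max_of_lt_left hC₀
  calc ∫⁻ z in closedBall 0 r, ENNReal.ofReal (‖z‖ ^ 2) * (U z : ℝ≥0∞)
      ≤ ∫⁻ z in closedBall 0 r, 4 * (ENNReal.ofReal (min (‖z‖ ^ 2) 1) * (U z : ℝ≥0∞)) := by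
        refine setLIntegral_mono' measurableSet_closedBall fun z hz => ?_
        rw [mem_closedBall_zero_iff] at hz
        rw [← mul_assoc]
        gcongr
        rw [← ENNReal.ofReal_ofNat 4, ← ENNReal.ofReal_mul (by norm_num)]
        refine ENNReal.ofReal_le_ofReal ?_
        rw [mul_min_of_nonneg _ _ (by norm_num : (0 : ℝ) ≤ 4)]
        exact le_min (by nlinarith [sq_nonneg ‖z‖]) (by nlinarith [norm_nonneg z])
    _ ≤ 4 * ∫⁻ z in ball 0 (2 * r), ENNReal.ofReal (min (‖z‖ ^ 2) 1) * (U z : ℝ≥0∞) := by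
        rw [lintegral_const_mul' _ _ (by simp)]
        gcongr
        exact closedBall_subset_ball (by linarith)
    _ ≤ 4 * ENNReal.ofReal (max C₀ C₁ * (2 * r) ^ (2 - α)) := by
        gcongr
        exact setLIntegral_ball_min_mul_le hα hC₀ h0 h1 (by positivity)
    _ ≤ _ := by
        rw [← ENNReal.ofReal_ofNat 4, ← ENNReal.ofReal_mul (by norm_num),
          ← ENNReal.ofReal_mul (by positivity)]
        refine ENNReal.ofReal_le_ofReal ?_
        have := two_mul_rpow_le hα0 hr
        nlinarith

lemma KernelBounds.ae_lower (h : KernelBounds k L U) :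
    ∀ᵐ x, ∀ᵐ y, L (x - y) ≤ k x y :=
  Measure.ae_ae_of_ae_prod (h.bounds.mono fun _ hp => hp.1)

lemma KernelBounds.ae_upper (h : KernelBounds k L U) (hU : U =ᵐ[volume] U') :
    ∀ᵐ x, ∀ᵐ y, k x y ≤ U' (x - y) := by
  have h1 : ∀ᵐ x, ∀ᵐ y, k x y ≤ U (x - y) :=
    Measure.ae_ae_of_ae_prod (h.bounds.mono fun _ hp => hp.2)
  filter_upwards [h1] with x hx
  have h2 : ∀ᵐ y, U (x - y) = U' (x - y) :=
    (quasiMeasurePreserving_sub_left volume x).ae hU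
  filter_upwards [hx, h2] with y hy hy'
  exact hy' ▸ hy

lemma gagliardoEnergy_eq (x₀ : EuclideanSpace ℝ (Fin d)) (r : ℝ)
    {u : EuclideanSpace ℝ (Fin d) → ℝ} (hu : Measurable u) :
    gagliardoEnergy α (ball x₀ r) u =
      ∫⁻ h, shiftEnergy volume (ball x₀ r) u h *
        gagliardoWeight (EuclideanSpace ℝ (Fin d)) α h := by
  rw [← lintegral_pairDiff_mul measurableSet_ball hu (measurable_gagliardoWeight α),
    ← setLIntegral_setLIntegral_eq_pairDiff measurableSet_ball u
      (fun x y => gagliardoWeight _ α (x - y))]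
  simp only [gagliardoEnergy, gagliardoWeight, div_eq_mul_inv,
    ENNReal.ofReal_mul (sq_nonneg _), finrank_euclideanSpace_fin]

lemma kernelEnergy_le_lintegral_shiftEnergy (h : KernelBounds k L U) (hU : U =ᵐ[volume] U')
    (hU' : Measurable U') (x₀ : EuclideanSpace ℝ (Fin d)) (r : ℝ)
    {u : EuclideanSpace ℝ (Fin d) → ℝ} (hu : Measurable u) :
    kernelEnergy k (ball x₀ r) u ≤ ∫⁻ h, shiftEnergy volume (ball x₀ r) u h * (U' h : ℝ≥0∞) := by
  rw [kernelEnergy, setLIntegral_setLIntegral_eq_pairDiff measurableSet_ball u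
      (fun x y => (k x y : ℝ≥0∞)), ← lintegral_pairDiff_mul measurableSet_ball hu (by fun_prop)]
  refine lintegral_mono_ae ?_
  filter_upwards [h.ae_upper hU] with x hx
  refine lintegral_mono_ae ?_
  filter_upwards [hx] with y hy
  gcongr

/-- A Borel minorant W avoids changing L on a null set, since (L1) is a pointwise bound. -/
lemma lintegral_shiftEnergy_le_kernelEnergy (h : KernelBounds k L U)
    {W : EuclideanSpace ℝ (Fin d) → ℝ≥0∞} (hW : Measurable W) (hWL : ∀ z, W z ≤ L z)
    (x₀ : EuclideanSpace ℝ (Fin d)) (r : ℝ)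
    {u : EuclideanSpace ℝ (Fin d) → ℝ} (hu : Measurable u) :
    ∫⁻ h, shiftEnergy volume (ball x₀ r) u h * W h ≤ kernelEnergy k (ball x₀ r) u := by
  rw [kernelEnergy, setLIntegral_setLIntegral_eq_pairDiff measurableSet_ball u
      (fun x y => (k x y : ℝ≥0∞)), ← lintegral_pairDiff_mul measurableSet_ball hu hW]
  refine lintegral_mono_ae ?_
  filter_upwards [h.ae_lower] with x hx
  refine lintegral_mono_ae ?_
  filter_upwards [hx] with y hy
  gcongr
  exact (hWL _).trans (by exact_mod_cast hy)

lemma exists_kernelEnergy_le (d : ℕ) (hC₀ : 0 < C₀) :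
    ∃ c : ℝ, 0 < c ∧ ∀ α, 0 < α → α < 2 →
      ∀ (k : EuclideanSpace ℝ (Fin d) → EuclideanSpace ℝ (Fin d) → ℝ≥0)
        (L U : EuclideanSpace ℝ (Fin d) → ℝ≥0), KernelBounds k L U → ConditionU0 C₀ U →
      ConditionU1 α C₁ U → ∀ (x₀ : EuclideanSpace ℝ (Fin d)) (r : ℝ), r < 1 →
      ∀ u : EuclideanSpace ℝ (Fin d) → ℝ, Measurable u →
      kernelEnergy k (ball x₀ r) u ≤
        ENNReal.ofReal c * (ENNReal.ofReal (2 - α) * gagliardoEnergy α (ball x₀ r) u) := by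
  obtain ⟨M, hM⟩ := exists_lintegral_shiftEnergy_mul_le
    (volume : Measure (EuclideanSpace ℝ (Fin d)))
  have hmax : 0 < max C₀ C₁ := lt_max_of_lt_left hC₀
  -- M + 1 rather than M keeps the constant positive.
  refine ⟨(M + 1) * (16 * max C₀ C₁), by positivity, ?_⟩
  intro α hα0 hα2 k L U hk h0 h1 x₀ r hr u hu
  have hUU := hk.aemeasurable_U.ae_eq_mk
  have h0' := h0.congr_ae hUU
  have h1' := h1.congr_ae hUU
  refine (kernelEnergy_le_lintegral_shiftEnergy hk hUU hk.aemeasurable_U.measurable_mk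
    x₀ r hu).trans ?_
  refine (hM α hα0 hα2 (ENNReal.ofReal (16 * max C₀ C₁)) _
    hk.aemeasurable_U.measurable_mk.coe_nnreal_ennreal
    (fun s hs hs2 => setLIntegral_closedBall_sq_mul_le hα0 hα2 hC₀ h0' h1' hs hs2)
    x₀ r hr u hu).trans ?_
  rw [gagliardoEnergy_eq x₀ r hu, ENNReal.ofReal_mul (p := (M : ℝ) + 1) (by positivity)]
  gcongr
  rw [← ENNReal.ofReal_coe_nnreal]
  exact ENNReal.ofReal_le_ofReal (by linarith)

lemma exists_le_kernelEnergy (d : ℕ) {a C₂ C₃ : ℝ} (ha : 1 < a) (hC₂ : 0 < C₂) (hC₃ : 0 < C₃) :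
    ∃ c : ℝ, 0 < c ∧ ∀ α, 0 < α → α < 2 →
      ∀ (k : EuclideanSpace ℝ (Fin d) → EuclideanSpace ℝ (Fin d) → ℝ≥0)
        (L U : EuclideanSpace ℝ (Fin d) → ℝ≥0), KernelBounds k L U → ConditionL1 α a C₂ C₃ L →
      ∀ (x₀ : EuclideanSpace ℝ (Fin d)) (r : ℝ), 0 < r → r < 1 →
      ∀ u : EuclideanSpace ℝ (Fin d) → ℝ, Measurable u →
      ENNReal.ofReal c * (ENNReal.ofReal (2 - α) * gagliardoEnergy α (ball x₀ r) u) ≤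
        kernelEnergy k (ball x₀ r) u := by
  have ha0 : 0 < a := by linarith
  -- Capping the radius constant at 1 only shrinks the balls, so the bounds of (L1) persist.
  obtain ⟨M, hM0, hM⟩ := exists_lintegral_shiftEnergy_weight_le (EuclideanSpace ℝ (Fin d))
    (b := a⁻¹) (c := min C₂ 1) (by positivity) (inv_lt_one_of_one_lt₀ ha) (by positivity)
    (min_le_right _ _)
  refine ⟨C₃ / M, by positivity, ?_⟩
  intro α hα0 hα2 k L U hk hL x₀ r hr0 hr1 u hu
  choose z hz hzL using hL
  have e1 : ∀ n : ℕ, a ^ (-(n : ℤ)) = a⁻¹ ^ n := fun n => by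
    rw [zpow_neg, zpow_natCast, inv_pow]
  have e2 : ∀ n : ℕ, a ^ (-(n : ℤ) + 1) = a⁻¹ ^ n / a⁻¹ := fun n => by
    rw [zpow_add₀ ha0.ne', e1, zpow_one, div_inv_eq_mul]
  simp only [e1, e2] at hz hzL
  have hsub : ∀ n, ball (z n) (min C₂ 1 * a⁻¹ ^ n) ⊆ ball (z n) (C₂ * a⁻¹ ^ n) := fun n =>
    ball_subset_ball (by gcongr; exact min_le_left _ _)
  have hzn : ∀ n, ∀ w ∈ ball (z n) (min C₂ 1 * a⁻¹ ^ n),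
      a⁻¹ ^ n ≤ ‖w‖ ∧ ‖w‖ < a⁻¹ ^ n / a⁻¹ := by
    intro n w hw
    have := hz n (hsub n hw)
    rw [mem_sdiff, mem_ball_zero_iff, mem_ball_zero_iff, not_lt] at this
    exact this.symm
  set κ : ℝ≥0∞ := ENNReal.ofReal (C₃ * (2 - α)) with hκ
  set B : Set (EuclideanSpace ℝ (Fin d)) := ⋃ n, ball (z n) (min C₂ 1 * a⁻¹ ^ n) with hB
  have hBm : MeasurableSet B := MeasurableSet.iUnion fun n => measurableSet_ball
  set W : EuclideanSpace ℝ (Fin d) → ℝ≥0∞ := B.indicator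
    (fun w => κ * gagliardoWeight (EuclideanSpace ℝ (Fin d)) α w) with hW
  have hWm : Measurable W := ((measurable_gagliardoWeight α).const_mul κ).indicator hBm
  have hWL : ∀ w, W w ≤ L w := by
    intro w
    by_cases hw : w ∈ B
    · rw [hW, indicator_of_mem hw]
      obtain ⟨n, hn⟩ := mem_iUnion.1 hw
      have h1 := hzL n w (hsub n hn)
      have h2 : -(d : ℝ) - α = -((d : ℝ) + α) := by ring
      rw [h2, Real.rpow_neg (norm_nonneg w)] at h1
      rw [hκ, gagliardoWeight, finrank_euclideanSpace_fin,
        ← ENNReal.ofReal_mul (mul_nonneg hC₃.le (by linarith)), ← ENNReal.ofReal_coe_nnreal]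
      exact ENNReal.ofReal_le_ofReal h1
    · rw [hW, indicator_of_notMem hw]
      exact zero_le
  refine le_trans ?_ (lintegral_shiftEnergy_le_kernelEnergy hk hWm hWL x₀ r hu)
  have h3 : ∫⁻ h, shiftEnergy volume (ball x₀ r) u h * W h =
      κ * ∫⁻ h in B, shiftEnergy volume (ball x₀ r) u h *
        gagliardoWeight (EuclideanSpace ℝ (Fin d)) α h := by
    rw [← lintegral_const_mul' _ _ ENNReal.ofReal_ne_top, ← lintegral_indicator hBm]
    refine lintegral_congr fun h => ?_
    by_cases hh : h ∈ B
    · simp only [hW, indicator_of_mem hh]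
      ring
    · simp only [hW, indicator_of_notMem hh, mul_zero]
  rw [h3, gagliardoEnergy_eq x₀ r hu]
  calc _ ≤ ENNReal.ofReal (C₃ / M) * (ENNReal.ofReal (2 - α) * (ENNReal.ofReal M *
        ∫⁻ h in B, shiftEnergy volume (ball x₀ r) u h *
          gagliardoWeight (EuclideanSpace ℝ (Fin d)) α h)) := by
        gcongr
        exact hM volume α hα0 hα2 z hzn x₀ r hr0 hr1 u hu
    _ = _ := by
        rw [← mul_assoc, ← mul_assoc, ← ENNReal.ofReal_mul (by positivity),
          ← ENNReal.ofReal_mul (mul_nonneg (by positivity) (by linarith)), hκ]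
        congr 2
        field_simp

end Kernels

/-! ### A radial cutoff with slope of order 1/ρ. -/

section Cutoff

/-- The function is C¹ on the compact interval [0,1] and factors through the projection onto it. -/
lemma Real.smoothTransition.exists_lipschitzWith : ∃ K : ℝ≥0, LipschitzWith K smoothTransition := by
  obtain ⟨K, hK⟩ := (Real.smoothTransition.contDiff (n := 1)).contDiffOn.exists_lipschitzOnWith
    one_ne_zero (convex_Icc (0 : ℝ) 1) isCompact_Icc
  refine ⟨K, LipschitzWith.of_dist_le_mul fun x y => ?_⟩
  rw [← Real.smoothTransition.projIcc (x := x), ← Real.smoothTransition.projIcc (x := y)]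
  refine (hK.dist_le_mul _ (Subtype.prop _) _ (Subtype.prop _)).trans ?_
  gcongr
  simpa [Subtype.dist_eq] using (LipschitzWith.projIcc (zero_le_one' ℝ)).dist_le_mul x y

lemma exists_cutoff (E : Type*) [NormedAddCommGroup E] [InnerProductSpace ℝ E] :
    ∃ K : ℝ, 0 < K ∧ ∀ R ρ : ℝ, 0 < R → 0 < ρ → ∃ τ : E → ℝ, ContDiff ℝ ∞ τ ∧ (∀ x, 0 ≤ τ x) ∧
      (∀ x, τ x ≤ 1) ∧ tsupport τ = closure (ball 0 (R + ρ)) ∧ (∀ x ∈ ball 0 R, τ x = 1) ∧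
      ∀ x y, |τ y - τ x| ≤ K / ρ * ‖x - y‖ := by
  obtain ⟨K, hK⟩ := Real.smoothTransition.exists_lipschitzWith
  refine ⟨2 * (K + 1), by positivity, fun R ρ hR hρ => ?_⟩
  -- q = (R + ρ)² - R², so the argument of S is 1 at |x| = R and 0 at |x| = R + ρ. Using |x|²
  -- instead of |x| keeps τ smooth at 0.
  set q : ℝ := ρ * (2 * R + ρ) with hq
  have hq0 : 0 < q := by positivity
  set S := Real.smoothTransition
  set τ : E → ℝ := fun x => S (((R + ρ) ^ 2 - ‖x‖ ^ 2) / q) with hτ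
  -- |x|² is not globally Lipschitz; truncating |x| at R + ρ leaves τ unchanged and bounds the
  -- slope.
  have htrunc : ∀ x, τ x = S (((R + ρ) ^ 2 - (min ‖x‖ (R + ρ)) ^ 2) / q) := by
    intro x
    rcases le_total ‖x‖ (R + ρ) with h | h
    · rw [min_eq_left h]
    · rw [min_eq_right h, sub_self, zero_div]
      refine Eq.trans ?_ Real.smoothTransition.zero.symm
      refine Real.smoothTransition.zero_of_nonpos ?_
      refine div_nonpos_of_nonpos_of_nonneg (sub_nonpos.2 ?_) hq0.le
      gcongr
  refine ⟨τ, ?_, fun x => Real.smoothTransition.nonneg _, fun x => Real.smoothTransition.le_one _,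
    ?_, ?_, ?_⟩
  · exact Real.smoothTransition.contDiff.comp
      ((contDiff_const.sub (contDiff_norm_sq ℝ)).div_const q)
  · rw [tsupport]
    congr 1
    ext x
    rw [Function.mem_support, mem_ball_zero_iff]
    constructor
    · intro h
      by_contra! h'
      refine h (Real.smoothTransition.zero_of_nonpos ?_)
      refine div_nonpos_of_nonpos_of_nonneg (sub_nonpos.2 ?_) hq0.le
      gcongr
    · intro h
      refine (Real.smoothTransition.pos_of_pos (div_pos (sub_pos.2 ?_) hq0)).ne'
      gcongr
  · intro x hx
    rw [mem_ball_zero_iff] at hx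
    refine Real.smoothTransition.one_of_one_le ?_
    rw [one_le_div hq0, hq]
    nlinarith [norm_nonneg x]
  · intro x y
    rw [htrunc x, htrunc y]
    have h1 := hK.dist_le_mul (((R + ρ) ^ 2 - (min ‖y‖ (R + ρ)) ^ 2) / q)
      (((R + ρ) ^ 2 - (min ‖x‖ (R + ρ)) ^ 2) / q)
    rw [Real.dist_eq, Real.dist_eq] at h1
    refine h1.trans ?_
    set s := min ‖x‖ (R + ρ)
    set t := min ‖y‖ (R + ρ)
    have hs0 : 0 ≤ s := le_min (norm_nonneg _) (by positivity)
    have ht0 : 0 ≤ t := le_min (norm_nonneg _) (by positivity)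
    have hs : s ≤ R + ρ := min_le_right _ _
    have ht : t ≤ R + ρ := min_le_right _ _
    have hst : |s - t| ≤ ‖x - y‖ :=
      (abs_min_sub_min_le_max _ _ _ _).trans
        (by simpa using abs_norm_sub_norm_le x y)
    have e : ((R + ρ) ^ 2 - t ^ 2) / q - ((R + ρ) ^ 2 - s ^ 2) / q = (s + t) / q * (s - t) := by
      field_simp
      ring
    have h2 : (s + t) / q ≤ 2 / ρ := by
      rw [div_le_div_iff₀ hq0 hρ, hq]
      nlinarith
    rw [e, abs_mul, abs_of_nonneg (by positivity : 0 ≤ (s + t) / q)]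
    calc (K : ℝ) * ((s + t) / q * |s - t|) ≤ (K + 1) * (2 / ρ * ‖x - y‖) := by
          gcongr
          linarith
      _ = _ := by ring

end Cutoff

/-! ### Mass of U away from the origin. -/

section Tail

variable {d : ℕ} {U : EuclideanSpace ℝ (Fin d) → ℝ≥0} {α α₀ C₀ C₁ : ℝ}

/-- Outside the unit ball (U0) suffices. Inside it, dyadic annuli growing from radius ρ have masses
bounded by a geometric sequence of ratio 2^(-α) < 2^(-α₀), which makes the constant uniform in α. -/
lemma setLIntegral_tail_le (hα₀ : 0 < α₀) (hα0 : α₀ < α) (hα : α < 2) (hC₀ : 0 < C₀)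
    (h0 : ConditionU0 C₀ U) (h1 : ConditionU1 α C₁ U) {ρ : ℝ} (hρ : 0 < ρ) (hρ1 : ρ < 1) :
    ∫⁻ z in (ball 0 ρ)ᶜ, (U z : ℝ≥0∞) ≤
      ENNReal.ofReal ((C₀ + 4 * max C₀ C₁ * (1 - (1 / 2 : ℝ) ^ α₀)⁻¹) * ρ ^ (-α)) := by
  have hmax : 0 < max C₀ C₁ := lt_max_of_lt_left hC₀
  set p : ℝ := (1 / 2 : ℝ) ^ α₀ with hp
  have hp0 : 0 < p := by positivity
  have hp1 : p < 1 := Real.rpow_lt_one (by norm_num) (by norm_num) hα₀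
  have hρα : 1 ≤ ρ ^ (-α) :=
    Real.one_le_rpow_of_pos_of_le_one_of_nonpos hρ hρ1.le (by linarith)
  set A : ℕ → Set (EuclideanSpace ℝ (Fin d)) := fun n =>
    {z | (ρ * 2 ^ n ≤ ‖z‖ ∧ ‖z‖ < ρ * 2 ^ (n + 1)) ∧ ‖z‖ < 1} with hA
  have hAm : ∀ n, MeasurableSet (A n) := fun n =>
    ((measurableSet_le measurable_const measurable_norm).inter
      (measurableSet_lt measurable_norm measurable_const)).inter
      (measurableSet_lt measurable_norm measurable_const)
  have hcover : (ball 0 ρ)ᶜ ⊆ (ball (0 : EuclideanSpace ℝ (Fin d)) 1)ᶜ ∪ ⋃ n, A n := by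
    intro z hz
    rw [mem_compl_iff, mem_ball_zero_iff, not_lt] at hz
    by_cases hz1 : ‖z‖ < 1
    · obtain ⟨n, hn1, hn2⟩ := exists_nat_pow_near ((one_le_div hρ).2 hz) (one_lt_two (α := ℝ))
      exact Or.inr (mem_iUnion.2
        ⟨n, ⟨(le_div_iff₀' hρ).1 hn1, (div_lt_iff₀' hρ).1 hn2⟩, hz1⟩)
    · exact Or.inl (by rwa [mem_compl_iff, mem_ball_zero_iff])
  have hfar : ∫⁻ z in (ball 0 1)ᶜ, (U z : ℝ≥0∞) ≤ ENNReal.ofReal (C₀ * ρ ^ (-α)) := by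
    calc ∫⁻ z in (ball 0 1)ᶜ, (U z : ℝ≥0∞)
        ≤ ∫⁻ z in (ball 0 1)ᶜ, ENNReal.ofReal (min (‖z‖ ^ 2) 1) * (U z : ℝ≥0∞) := by
          refine setLIntegral_mono' measurableSet_ball.compl fun z hz => ?_
          rw [mem_compl_iff, mem_ball_zero_iff, not_lt] at hz
          rw [min_eq_right (by nlinarith), ENNReal.ofReal_one, one_mul]
      _ ≤ ENNReal.ofReal C₀ := (setLIntegral_le_lintegral _ _).trans h0
      _ ≤ _ := ENNReal.ofReal_le_ofReal (by nlinarith)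
  have hann : ∀ n, ∫⁻ z in A n, (U z : ℝ≥0∞) ≤
      ENNReal.ofReal (4 * max C₀ C₁ * ρ ^ (-α)) * ENNReal.ofReal p ^ n := by
    intro n
    set s : ℝ := ρ * 2 ^ n with hs
    have hs0 : 0 < s := by positivity
    calc ∫⁻ z in A n, (U z : ℝ≥0∞)
        ≤ ∫⁻ z in A n, ENNReal.ofReal ((s ^ 2)⁻¹) *
            (ENNReal.ofReal (min (‖z‖ ^ 2) 1) * (U z : ℝ≥0∞)) := by
          refine setLIntegral_mono' (hAm n) fun z hz => ?_
          rw [← mul_assoc, ← ENNReal.ofReal_mul (by positivity),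
            min_eq_left (by nlinarith [hz.2, norm_nonneg z])]
          refine le_mul_of_one_le_left' (ENNReal.one_le_ofReal.2 ?_)
          rw [← div_eq_inv_mul, one_le_div (by positivity)]
          have := hz.1.1
          gcongr
      _ ≤ ENNReal.ofReal ((s ^ 2)⁻¹) *
            ∫⁻ z in ball 0 (2 * s), ENNReal.ofReal (min (‖z‖ ^ 2) 1) * (U z : ℝ≥0∞) := by
          rw [lintegral_const_mul' _ _ ENNReal.ofReal_ne_top]
          gcongr
          intro z hz
          rw [mem_ball_zero_iff]
          have := hz.1.2
          rw [pow_succ] at this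
          linarith
      _ ≤ ENNReal.ofReal ((s ^ 2)⁻¹) * ENNReal.ofReal (max C₀ C₁ * (2 * s) ^ (2 - α)) := by
          gcongr
          exact setLIntegral_ball_min_mul_le hα hC₀ h0 h1 (by positivity)
      _ ≤ _ := by
          rw [← ENNReal.ofReal_pow hp0.le, ← ENNReal.ofReal_mul (by positivity),
            ← ENNReal.ofReal_mul (by positivity)]
          refine ENNReal.ofReal_le_ofReal ?_
          have e1 : s ^ (2 - α) = s ^ 2 * s ^ (-α) := by
            rw [← Real.rpow_natCast s 2, ← Real.rpow_add hs0]
            norm_num [sub_eq_add_neg]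
          have e2 : s ^ (-α) ≤ ρ ^ (-α) * p ^ n := by
            rw [hs, Real.mul_rpow hρ.le (by positivity)]
            gcongr
            calc ((2 : ℝ) ^ n) ^ (-α) = ((1 / 2 : ℝ) ^ α) ^ n := by
                  rw [← Real.rpow_natCast, ← Real.rpow_natCast, ← Real.rpow_mul (by norm_num),
                    ← Real.rpow_mul (by norm_num), one_div, Real.inv_rpow (by norm_num),
                    ← Real.rpow_neg (by norm_num)]
                  congr 1
                  ring
              _ ≤ p ^ n := by
                  gcongr ?_ ^ n
                  exact Real.rpow_le_rpow_of_exponent_ge (by norm_num) (by norm_num) hα0.le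
          calc (s ^ 2)⁻¹ * (max C₀ C₁ * (2 * s) ^ (2 - α))
              ≤ (s ^ 2)⁻¹ * (max C₀ C₁ * (4 * s ^ (2 - α))) := by
                gcongr
                exact two_mul_rpow_le (hα₀.trans hα0) hs0
            _ = 4 * max C₀ C₁ * s ^ (-α) := by
                rw [e1]
                field_simp
            _ ≤ 4 * max C₀ C₁ * (ρ ^ (-α) * p ^ n) := by gcongr
            _ = _ := by ring
  calc ∫⁻ z in (ball 0 ρ)ᶜ, (U z : ℝ≥0∞)
      ≤ (∫⁻ z in (ball 0 1)ᶜ, (U z : ℝ≥0∞)) + ∑' n, ∫⁻ z in A n, (U z : ℝ≥0∞) :=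
        (lintegral_mono_set hcover).trans ((lintegral_union_le _ _ _).trans
          (add_le_add le_rfl (lintegral_iUnion_le _ _)))
    _ ≤ ENNReal.ofReal (C₀ * ρ ^ (-α)) +
          ∑' n, ENNReal.ofReal (4 * max C₀ C₁ * ρ ^ (-α)) * ENNReal.ofReal p ^ n :=
        add_le_add hfar (ENNReal.tsum_le_tsum hann)
    _ = _ := by
        have hp' : 0 < 1 - p := by linarith
        rw [ENNReal.tsum_mul_left, ENNReal.tsum_geometric, ← ENNReal.ofReal_one,
          ← ENNReal.ofReal_sub _ hp0.le, ← ENNReal.ofReal_inv_of_pos hp',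
          ← ENNReal.ofReal_mul (by positivity), ← ENNReal.ofReal_add (by positivity)
            (by positivity)]
        congr 1
        ring

end Tail

/-! ### Conditions (A) and (B). -/

theorem conditionA_admissibleKernels (d : ℕ) {α₀ : ℝ} (hα₀ : 0 ≤ α₀) {a C₀ C₂ C₃ : ℝ} (C₁ : ℝ)
    (ha : 1 < a) (hC₀ : 0 < C₀) (hC₂ : 0 < C₂) (hC₃ : 0 < C₃) :
    ConditionA α₀ (admissibleKernels d a C₀ C₁ C₂ C₃) := by
  obtain ⟨c₁, hc₁, h₁⟩ := exists_le_kernelEnergy d ha hC₂ hC₃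
  obtain ⟨c₂, hc₂, h₂⟩ := exists_kernelEnergy_le (C₁ := C₁) d hC₀
  refine ⟨c₁, c₂, hc₁, hc₂, ?_⟩
  rintro α ⟨hα0, hα2⟩ k ⟨L, U, hk, hU0, hU1, hL⟩ x₀ r ⟨hr0, hr1⟩ u hu - -
  have hum : Measurable u := hu.continuous.measurable
  exact ⟨h₁ α (hα₀.trans_lt hα0) hα2 k L U hk hL x₀ r hr0 hr1 u hum,
    h₂ α (hα₀.trans_lt hα0) hα2 k L U hk hU0 hU1 x₀ r hr1 u hum⟩

theorem conditionB_admissibleKernels (d : ℕ) {α₀ : ℝ} (hα₀ : 0 < α₀) {C₀ C₁ : ℝ} (a C₂ C₃ : ℝ)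
    (hC₀ : 0 < C₀) (hC₁ : 0 < C₁) :
    ConditionB α₀ (admissibleKernels d a C₀ C₁ C₂ C₃) := by
  obtain ⟨K, hK, hcut⟩ := exists_cutoff (EuclideanSpace ℝ (Fin d))
  set T : ℝ := C₀ + 4 * max C₀ C₁ * (1 - (1 / 2 : ℝ) ^ α₀)⁻¹ with hT
  have hp1 : 0 < 1 - (1 / 2 : ℝ) ^ α₀ :=
    sub_pos.2 (Real.rpow_lt_one (by norm_num) (by norm_num) hα₀)
  have hT0 : 0 < T := by positivity
  refine ⟨K ^ 2 * C₁ + T, by positivity, ?_⟩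
  rintro R ⟨hR, -⟩ ρ ⟨hρ, hρ1⟩
  obtain ⟨τ, hτ, hτ0, hτ1, hsupp, hone, hlip⟩ := hcut R ρ hR hρ
  refine ⟨τ, hτ, hτ0, hsupp, hone, ?_⟩
  rintro α ⟨hα0, hα2⟩ k ⟨L, U, hk, hU0, hU1, -⟩
  have hUU := hk.aemeasurable_U.ae_eq_mk
  set U' := hk.aemeasurable_U.mk U
  have hU0' := hU0.congr_ae hUU
  have hU1' := hU1.congr_ae hUU
  refine essSup_le_of_ae_le _ ?_
  filter_upwards [hk.ae_upper hUU] with x hx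
  -- The Lipschitz bound serves for |h| < ρ, the trivial bound |τ y - τ x| ≤ 1 for |h| ≥ ρ.
  set F : EuclideanSpace ℝ (Fin d) → ℝ≥0∞ := fun h =>
    ENNReal.ofReal (min ((K / ρ) ^ 2 * ‖h‖ ^ 2) 1) * (U' h : ℝ≥0∞) with hF
  have hnear : ∫⁻ h in ball 0 ρ, F h ≤ ENNReal.ofReal (K ^ 2 * C₁ * ρ ^ (-α)) := by
    calc ∫⁻ h in ball 0 ρ, F h
        ≤ ∫⁻ h in ball 0 ρ, ENNReal.ofReal ((K / ρ) ^ 2) *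
            (ENNReal.ofReal (‖h‖ ^ 2) * (U' h : ℝ≥0∞)) := by
          refine lintegral_mono fun h => ?_
          rw [← mul_assoc, ← ENNReal.ofReal_mul (by positivity)]
          simp only [hF]
          gcongr
          exact min_le_left _ _
      _ ≤ ENNReal.ofReal ((K / ρ) ^ 2) * ENNReal.ofReal (C₁ * ρ ^ (2 - α)) := by
          rw [lintegral_const_mul' _ _ ENNReal.ofReal_ne_top]
          gcongr
          exact hU1' ρ ⟨hρ, hρ1⟩
      _ = _ := by
          rw [← ENNReal.ofReal_mul (by positivity)]
          congr 1
          have e1 : ρ ^ (2 - α) = ρ ^ 2 * ρ ^ (-α) := by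
            rw [← Real.rpow_natCast ρ 2, ← Real.rpow_add hρ]
            norm_num [sub_eq_add_neg]
          rw [e1]
          field_simp
  have hfar : ∫⁻ h in (ball 0 ρ)ᶜ, F h ≤ ENNReal.ofReal (T * ρ ^ (-α)) := by
    refine le_trans (lintegral_mono fun h => ?_)
      (setLIntegral_tail_le hα₀ hα0 hα2 hC₀ hU0' hU1' hρ hρ1)
    refine mul_le_of_le_one_left' ?_
    exact ENNReal.ofReal_le_one.2 (min_le_right _ _)
  calc ∫⁻ y, ENNReal.ofReal ((τ y - τ x) ^ 2) * (k x y : ℝ≥0∞)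
      ≤ ∫⁻ y, F (x - y) := by
        refine lintegral_mono_ae ?_
        filter_upwards [hx] with y hy
        simp only [hF]
        refine mul_le_mul' (ENNReal.ofReal_le_ofReal (le_min ?_ ?_)) (by exact_mod_cast hy)
        · rw [← mul_pow]
          exact sq_le_sq.2 ((hlip x y).trans (le_abs_self _))
        · rw [sq_le_one_iff_abs_le_one, abs_le]
          constructor <;> linarith [hτ0 x, hτ0 y, hτ1 x, hτ1 y]
    _ = ∫⁻ h, F h := lintegral_sub_left_eq_self F x
    _ = (∫⁻ h in ball 0 ρ, F h) + ∫⁻ h in (ball 0 ρ)ᶜ, F h :=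
        (lintegral_add_compl F measurableSet_ball).symm
    _ ≤ ENNReal.ofReal (K ^ 2 * C₁ * ρ ^ (-α)) + ENNReal.ofReal (T * ρ ^ (-α)) :=
        add_le_add hnear hfar
    _ = _ := by
        rw [← ENNReal.ofReal_add (by positivity) (by positivity), ← add_mul]

theorem theorem1p1 (d : ℕ) (hd : 1 ≤ d) (α₀ : ℝ) (hα₀ : α₀ ∈ Set.Ioo (0 : ℝ) 2)
    (a C₀ C₁ C₂ C₃ : ℝ) (ha : 1 < a) (hC₀ : 0 < C₀) (hC₁ : 0 < C₁) (hC₂ : 0 < C₂) (hC₃ : 0 < C₃) :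
    ConditionA α₀ (admissibleKernels d a C₀ C₁ C₂ C₃) ∧
    ConditionB α₀ (admissibleKernels d a C₀ C₁ C₂ C₃) :=
  ⟨conditionA_admissibleKernels d hα₀.1.le C₁ ha hC₀ hC₂ hC₃,
    conditionB_admissibleKernels d hα₀.1 a C₂ C₃ hC₀ hC₁⟩
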